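/- The cake is $[0,1]$; a piece is a finite union of disjoint closed subintervals of $[0,1]$, and it is contiguous if it is a single closed interval (possibly a single point). A contiguous division into three pieces is a triple $(A_1,A_2,A_3)$ of contiguous pieces that cover $[0,1]$ and have pairwise disjoint interiors. Let $n\ge 3$. Each agent $i\in\{1,\dots,n\}$ has a valuation $v_i$ that assigns a real number to every piece, is monotone ($v_i(L)\le v_i(L')$ whenever $L\subseteq L'$) and Lipschitz with constant $K\ge 0$ ($|v_i(L)-v_i(L')|\le K\,\mu(L\,\triangle\,L')$ for all pieces $L,L'$, where $\mu$ is the Lebesgue measure). Let $k_1,k_2,k_3$ be positive integers with $k_1+k_2+k_3=n$, and let $\varepsilon>0$. Agent $n$ is the birthday agent. Then one can compute, in time $O\!\left(n\log^2\frac{K}{\varepsilon}\right)$, a contiguous division $(A_1,A_2,A_3)$ of the cake such that, for every $j^*\in\{1,2,3\}$, there is an assignment $\pi\colon\{1,\dots,n\}\to\{1,2,3\}$ with - $\pi(n)=j^*$, - $v_i(A_{\pi(i)})+\varepsilon\ge\max_{j\in\{1,2,3\}}v_i(A_j)$ for every $i\in\{1,\dots,n-1\}$, and - $|\pi^{-1}(j)|=k_j$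 for every $j\in\{1,2,3\}$. Here a single algorithm works for all instances. It is given $n,k_1,k_2,k_3,K,\varepsilon$, it does not use the valuation of the birthday agent, and it is run on a random access machine with exact real arithmetic, on which each arithmetic operation, each comparison and each query for the value $v_i([a,b])$ of an interval to an agent $i<n$ takes one unit of time. The time bound means that there is an absolute constant $C$ such that the running time is at most $C\,n\log^2\!\left(2+\frac{K}{\varepsilon}\right)$ on every instance; in particular it is $O(n\log^2\frac K\varepsilon)$ for $\frac K\varepsilon\ge 2$. -/

import Mathlib

open MeasureTheory Set
open scoped symmDiff

noncomputable section

namespace CakeCutting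

/-! ### The cake, pieces, divisions and valuations (one layer) -/

/-- A piece of the cake `[0,1]`: a union of finitely many disjoint closed subintervals of `[0,1]`
(an interval may be a single point). -/
def IsPiece (s : Set ℝ) : Prop :=
  ∃ S : Finset (ℝ × ℝ),
    (∀ p ∈ S, 0 ≤ p.1 ∧ p.1 ≤ p.2 ∧ p.2 ≤ 1) ∧
    (S : Set (ℝ × ℝ)).PairwiseDisjoint (fun p => Icc p.1 p.2) ∧
    s = ⋃ p ∈ S, Icc p.1 p.2

/-- The type of all pieces of the cake. -/
def Piece : Type := {s : Set ℝ // IsPiece s}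

/-- The underlying set of points of a piece. -/
def Piece.carrier (L : Piece) : Set ℝ := L.1

theorem isPiece_Icc {a b : ℝ} (h : 0 ≤ a ∧ a ≤ b ∧ b ≤ 1) : IsPiece (Icc a b) :=
  ⟨{(a, b)}, by simpa using h, by simp, by simp⟩

/-- The closed interval `[a,b]` as a piece of the cake. -/
def Piece.interval (a b : ℝ) (h : 0 ≤ a ∧ a ≤ b ∧ b ≤ 1) : Piece := ⟨Icc a b, isPiece_Icc h⟩

/-- A piece is contiguous if it is a single closed interval. -/
def Piece.IsContiguous (L : Piece) : Prop := ∃ a b : ℝ, a ≤ b ∧ L.carrier = Icc a b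

/-- The pieces `A 0`, `A 1`, `A 2` partition the cake: they cover it and have pairwise disjoint
interiors. (For a single layer no further feasibility condition is needed: non-overlapping is a
condition on pairs of distinct layers.) -/
def IsDivision (A : Fin 3 → Piece) : Prop :=
  (⋃ j, (A j).carrier) = Icc (0 : ℝ) 1 ∧
  ∀ i j, i ≠ j → Disjoint (interior (A i).carrier) (interior (A j).carrier)

/-- A valuation function assigns a real value to every piece. -/
abbrev Valuation : Type := Piece → ℝ

/-- Monotonicity of a valuation with respect to inclusion of pieces. -/
def Valuation.IsMonotone (v : Valuation) : Prop :=
  ∀ L L' : Piece, L.carrier ⊆ L'.carrier → v L ≤ v L'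

/-- The Lipschitz condition with constant `K`, with respect to the Lebesgue measure of the
symmetric difference. -/
def Valuation.IsLipschitz (K : ℝ) (v : Valuation) : Prop :=
  ∀ L L' : Piece, |v L - v L'| ≤ K * (volume (L.carrier ∆ L'.carrier)).toReal

/-! ### The machine model: a real random access machine with unit costs and value queries

The store has natural number registers and real registers, with direct and indirect addressing.
Exact arithmetic on one or two registers, a comparison, and a value query each take one time unit.
Neither rounding of reals nor multiplication of naturals is available. -/

/-- A store of the machine. -/
structure Store where
  nat : ℕ → ℕ
  real : ℕ → ℝ

/-- Write to a natural number register. -/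
def Store.setNat (s : Store) (d x : ℕ) : Store := { s with nat := Function.update s.nat d x }

/-- Write to a real register. -/
def Store.setReal (s : Store) (d : ℕ) (x : ℝ) : Store :=
  { s with real := Function.update s.real d x }

/-- The elementary instructions. The parameters `d a b i` are addresses of registers. -/
inductive Instr where
  | natConst (d c : ℕ)
  | natCopy (d a : ℕ)
  | natAdd (d a b : ℕ)
  | natSub (d a b : ℕ)
  | natLoad (d i : ℕ)
  | natStore (i a : ℕ)
  | realConst (d : ℕ) (c : ℚ)
  | realCopy (d a : ℕ)
  | realAdd (d a b : ℕ)
  | realSub (d a b : ℕ)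
  | realMul (d a b : ℕ)
  | realDiv (d a b : ℕ)
  | realOfNat (d a : ℕ)
  | realLoad (d i : ℕ)
  | realStore (i a : ℕ)
  | query (d i a b : ℕ)

/-- A value oracle: `O i a b` is the answer to the query about agent `i` and the interval
`[a,b]`. -/
abbrev Oracle : Type := ℕ → ℝ → ℝ → ℝ

/-- The effect of an elementary instruction. -/
def Instr.apply (O : Oracle) (s : Store) : Instr → Store
  | natConst d c => s.setNat d c
  | natCopy d a => s.setNat d (s.nat a)
  | natAdd d a b => s.setNat d (s.nat a + s.nat b)
  | natSub d a b => s.setNat d (s.nat a - s.nat b)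
  | natLoad d i => s.setNat d (s.nat (s.nat i))
  | natStore i a => s.setNat (s.nat i) (s.nat a)
  | realConst d c => s.setReal d (c : ℝ)
  | realCopy d a => s.setReal d (s.real a)
  | realAdd d a b => s.setReal d (s.real a + s.real b)
  | realSub d a b => s.setReal d (s.real a - s.real b)
  | realMul d a b => s.setReal d (s.real a * s.real b)
  | realDiv d a b => s.setReal d (s.real a / s.real b)
  | realOfNat d a => s.setReal d (s.nat a : ℝ)
  | realLoad d i => s.setReal d (s.real (s.nat i))
  | realStore i a => s.setReal (s.nat i) (s.real a)
  | query d i a b => s.setReal d (O (s.nat i) (s.real a) (s.real b))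

/-- The elementary tests: comparisons of two registers. -/
inductive Test where
  | natLt (a b : ℕ)
  | natEq (a b : ℕ)
  | realLt (a b : ℕ)
  | realLe (a b : ℕ)

/-- The outcome of a test. -/
def Test.Holds (s : Store) : Test → Prop
  | natLt a b => s.nat a < s.nat b
  | natEq a b => s.nat a = s.nat b
  | realLt a b => s.real a < s.real b
  | realLe a b => s.real a ≤ s.real b

/-- Programs: finite texts built from instructions by sequencing, branching and (while-)loops. -/
inductive Program where
  | skip
  | instr (c : Instr)
  | seq (p q : Program)
  | ite (b : Test) (p q : Program)
  | loop (b : Test) (p : Program)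

/-- `Exec O p s s' t`: with the oracle `O`, program `p` started in the store `s` halts in the store
`s'` after exactly `t` time units. Each instruction and each evaluation of a test costs one unit. -/
inductive Exec (O : Oracle) : Program → Store → Store → ℕ → Prop where
  | skip (s : Store) : Exec O .skip s s 1
  | instr (c : Instr) (s : Store) : Exec O (.instr c) s (c.apply O s) 1
  | seq {p q : Program} {s₀ s₁ s₂ : Store} {t₁ t₂ : ℕ} :
      Exec O p s₀ s₁ t₁ → Exec O q s₁ s₂ t₂ → Exec O (.seq p q) s₀ s₂ (t₁ + t₂)
  | iteTrue {b : Test} {p q : Program} {s s' : Store} {t : ℕ} :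
      b.Holds s → Exec O p s s' t → Exec O (.ite b p q) s s' (t + 1)
  | iteFalse {b : Test} {p q : Program} {s s' : Store} {t : ℕ} :
      ¬ b.Holds s → Exec O q s s' t → Exec O (.ite b p q) s s' (t + 1)
  | loopTrue {b : Test} {p : Program} {s₀ s₁ s₂ : Store} {t₁ t₂ : ℕ} :
      b.Holds s₀ → Exec O p s₀ s₁ t₁ → Exec O (.loop b p) s₁ s₂ t₂ →
      Exec O (.loop b p) s₀ s₂ (t₁ + t₂ + 1)
  | loopFalse {b : Test} {p : Program} {s : Store} :
      ¬ b.Holds s → Exec O (.loop b p) s s 1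

/-- The machine is deterministic: final store and running time are determined by the program, the
oracle and the starting store. -/
theorem Exec.deterministic {O : Oracle} {p : Program} {s s₁ s₂ : Store} {t₁ t₂ : ℕ}
    (h₁ : Exec O p s s₁ t₁) (h₂ : Exec O p s s₂ t₂) : s₁ = s₂ ∧ t₁ = t₂ := by
  induction h₁ generalizing s₂ t₂ with
  | skip s => cases h₂; exact ⟨rfl, rfl⟩
  | instr c s => cases h₂; exact ⟨rfl, rfl⟩
  | seq _ _ ih₁ ih₂ =>
    cases h₂ with
    | seq a b =>
      obtain ⟨rfl, rfl⟩ := ih₁ a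
      obtain ⟨rfl, rfl⟩ := ih₂ b
      exact ⟨rfl, rfl⟩
  | iteTrue hb _ ih =>
    cases h₂ with
    | iteTrue _ a => obtain ⟨rfl, rfl⟩ := ih a; exact ⟨rfl, rfl⟩
    | iteFalse hb' _ => exact absurd hb hb'
  | iteFalse hb _ ih =>
    cases h₂ with
    | iteTrue hb' _ => exact absurd hb' hb
    | iteFalse _ a => obtain ⟨rfl, rfl⟩ := ih a; exact ⟨rfl, rfl⟩
  | loopTrue hb _ _ ih₁ ih₂ =>
    cases h₂ with
    | loopTrue _ a b =>
      obtain ⟨rfl, rfl⟩ := ih₁ a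
      obtain ⟨rfl, rfl⟩ := ih₂ b
      exact ⟨rfl, rfl⟩
    | loopFalse hb' => exact absurd hb hb'
  | loopFalse hb =>
    cases h₂ with
    | loopTrue hb' _ _ => exact absurd hb' hb
    | loopFalse _ => exact ⟨rfl, rfl⟩

/-! ### Input, queries and output -/

open Classical in
/-- The value oracle of an instance with `n` agents. The agents are `0, …, n - 1`, and the last one,
`n - 1`, is the birthday agent, about whom the machine cannot inquire: the answer about any other
agent `i` and any interval `[a,b] ⊆ [0,1]` is the value of `[a,b]` to `i`, and the
answer to an ill-formed query is `0`. -/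
def valueOracle {n : ℕ} (v : Fin n → Valuation) : Oracle := fun i a b =>
  if h : i + 1 < n ∧ 0 ≤ a ∧ a ≤ b ∧ b ≤ 1 then
    v ⟨i, Nat.lt_of_succ_lt h.1⟩ (Piece.interval a b h.2)
  else 0

/-- The starting store: the natural number registers `0, 1, 2, 3` hold `n` and the three group
sizes, the real registers `0, 1` hold `K` and `ε`, all other registers hold `0`. -/
def inputStore (n : ℕ) (k : Fin 3 → ℕ) (K ε : ℝ) : Store where
  nat := fun r =>
    if r = 0 then n else if r = 1 then k 0 else if r = 2 then k 1 else if r = 3 then k 2 else 0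
  real := fun r => if r = 0 then K else if r = 1 then ε else 0

/-- The output convention: piece `j` is the interval whose left and right end are in the real
registers `2 j` and `2 j + 1` when the machine halts. -/
def Outputs (s : Store) (A : Fin 3 → Piece) : Prop :=
  ∀ j : Fin 3, s.real (2 * j.val) ≤ s.real (2 * j.val + 1) ∧
    (A j).carrier = Icc (s.real (2 * j.val)) (s.real (2 * j.val + 1))

/-- No matter which piece `j₀` the birthday agent `n - 1` takes, the other agents can be assigned
to pieces that are `ε`-approximately preferred by them, so that each piece `j` is assigned to
exactly `k j` of the `n` agents, the birthday agent included. -/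
def IsApproxBirthdayEnvyFree {n : ℕ} (v : Fin n → Valuation) (k : Fin 3 → ℕ) (ε : ℝ)
    (A : Fin 3 → Piece) : Prop :=
  ∀ j₀ : Fin 3, ∃ π : Fin n → Fin 3,
    (∀ i : Fin n, i.val + 1 = n → π i = j₀) ∧
    (∀ i : Fin n, i.val + 1 < n → ∀ j : Fin 3, v i (A j) ≤ v i (A (π i)) + ε) ∧
    (∀ j : Fin 3, (Finset.univ.filter (fun i : Fin n => π i = j)).card = k j)

end CakeCutting

end

/-!
Cut the cake at `x ≤ y` into `[0,x]`, `[x,y]`, `[y,1]`, the pieces `0`, `1`, `2`, and let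
`m = n - 1` be the number of agents other than the birthday agent. Say that piece `j` is *demanded
with margin `t`* (`Demand`) if at least `k j` of them prefer it to the two other pieces by at least
`t`. If every piece is demanded with margin `-ε` and none with margin `ε`, then Hall's condition
holds whichever piece the birthday agent takes (`exists_assignment`). So all that is needed is a
pair `(x, y)` where the three numbers `h j`, the largest margin with which `j` is demanded, are
nearly `0`. Since `k 0 + k 1 + k 2 = m + 1`, the three margins cannot all be positive
(`not_forall_demand`), and if two of them are negative, then the third is positive
(`demand_of_not_demand`).

By monotonicity `h 2` is non-increasing in `y`. So for each `x` a bisection in `y` finds a point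
with `h 2` nearly `0`, or else `h 2` is negative already on the diagonal `y = x`. These points form
a "curve" (`OnCurve`). On it, the two facts above show that at least one of two labels applies:
`h 0` is at most about `0` and `h 1` at least about `0` (`LeftLabel`), or the other way round
(`RightLabel`). The left label applies at `x = 0`, where piece `0` is worthless, and the right one
at `x = y = 1`. A bisection in `x` therefore finds two points of the curve with different labels and
first cuts that nearly coincide. Their second cuts may be far apart, but as `h 2` is monotone in
`y`, it is nearly `0` at all points in between in the same column, so both labels still make sense
there, and a last bisection, in `y`, finds a point to which both labels apply approximately
(`Bracket.solution`).

Deciding whether a piece is demanded with a given margin takes one pass over the agents, and no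
selection. Each bisection takes `O(log (2 + K / ε))` steps; the first two are nested.
-/

namespace CakeCutting

/-! ### Demand counts and the birthday assignment -/

/-- With `w l` the value of piece `l`, piece `j` beats every other piece by at least `t`
(for negative `t`: is at most `-t` worse than every other piece). -/
def Prefers (w : Fin 3 → ℝ) (j : Fin 3) (t : ℝ) : Prop := ∀ l, l ≠ j → w l + t ≤ w j

open Classical in
/-- At least `k j` of the agents `0, …, m - 1` prefer piece `j` by the margin `t`. In other words,
the `k j`-th largest of the agents' margins for piece `j` is at least `t`. -/
def Demand (m : ℕ) (k : Fin 3 → ℕ) (w : ℕ → Fin 3 → ℝ) (j : Fin 3) (t : ℝ) : Prop :=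
  k j ≤ ((Finset.range m).filter (fun i => Prefers (w i) j t)).card

section Demand

variable {m : ℕ} {k : Fin 3 → ℕ} {w w' : ℕ → Fin 3 → ℝ} {j : Fin 3} {s t : ℝ}

theorem Prefers.anti {u : Fin 3 → ℝ} (h : Prefers u j t) (hst : s ≤ t) : Prefers u j s :=
  fun l hl => by linarith [h l hl]

theorem Demand.imp (h : Demand m k w j t)
    (hw : ∀ i < m, Prefers (w i) j t → Prefers (w' i) j s) : Demand m k w' j s := by
  classical
  refine le_trans h (Finset.card_le_card fun i hi => ?_)
  simp only [Finset.mem_filter, Finset.mem_range] at hi ⊢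
  exact ⟨hi.1, hw i hi.1 hi.2⟩

theorem Demand.anti (h : Demand m k w j t) (hst : s ≤ t) : Demand m k w j s :=
  h.imp fun _ _ hp => hp.anti hst

theorem Demand.perturb (h : Demand m k w j t) {d : ℝ}
    (hw : ∀ i < m, ∀ l, |w i l - w' i l| ≤ d) (hst : s + 2 * d ≤ t) : Demand m k w' j s := by
  refine h.imp fun i hi hp l hl => ?_
  have h1 := abs_le.1 (hw i hi l)
  have h2 := abs_le.1 (hw i hi j)
  linarith [hp l hl]

theorem Demand.exists_prefers (h : Demand m k w j t) (hk : 0 < k j) :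
    ∃ i < m, Prefers (w i) j t := by
  classical
  obtain ⟨i, hi⟩ := Finset.card_pos.1 (lt_of_lt_of_le hk h)
  simp only [Finset.mem_filter, Finset.mem_range] at hi
  exact ⟨i, hi⟩

theorem demand_of_forall (hk : k j ≤ m) (h : ∀ i < m, Prefers (w i) j t) : Demand m k w j t := by
  classical
  unfold Demand
  rwa [Finset.filter_true_of_mem fun i hi => h i (Finset.mem_range.1 hi), Finset.card_range]

/-- Margins with positive pairwise sums cannot all be demanded: the three groups of agents would be
disjoint, and there is one agent too few. -/
theorem not_forall_demand (hk : k 0 + k 1 + k 2 = m + 1) (t : Fin 3 → ℝ)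
    (ht : ∀ a b, a ≠ b → 0 < t a + t b) : ¬ ∀ j, Demand m k w j (t j) := by
  classical
  intro h
  let F : Fin 3 → Finset ℕ := fun j => (Finset.range m).filter (fun i => Prefers (w i) j (t j))
  have hd : ((Finset.univ : Finset (Fin 3)) : Set (Fin 3)).PairwiseDisjoint F := by
    intro a _ b _ hab
    refine Finset.disjoint_left.2 fun i hi hi' => ?_
    simp only [F, Finset.mem_filter] at hi hi'
    linarith [hi.2 b hab.symm, hi'.2 a hab, ht a b hab]
  have h1 : (Finset.univ.biUnion F).card ≤ (Finset.range m).card :=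
    Finset.card_le_card (Finset.biUnion_subset.2 fun j _ => Finset.filter_subset _ _)
  rw [Finset.card_biUnion hd, Fin.sum_univ_three, Finset.card_range] at h1
  have h2 : ∀ j, k j ≤ (F j).card := h
  have := h2 0
  have := h2 1
  have := h2 2
  omega

/-- If two pieces are not demanded, then many agents prefer neither of the two, enough to make up
the group of the third piece. -/
theorem le_card_of_not_demand (hk : k 0 + k 1 + k 2 = m + 1) {a b c : Fin 3} (hab : a ≠ b)
    (hac : a ≠ c) (hbc : b ≠ c) (ha : ¬ Demand m k w a s) (hb : ¬ Demand m k w b t)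
    (P : ℕ → Prop) [DecidablePred P]
    (hP : ∀ i < m, ¬ Prefers (w i) a s → ¬ Prefers (w i) b t → P i) :
    k c ≤ ((Finset.range m).filter P).card := by
  classical
  simp only [Demand, not_le] at ha hb
  have h1 : (Finset.range m).card ≤ ((Finset.range m).filter (fun i => Prefers (w i) a s) ∪
      (Finset.range m).filter (fun i => Prefers (w i) b t) ∪ (Finset.range m).filter P).card := by
    refine Finset.card_le_card fun i hi => ?_
    simp only [Finset.mem_union, Finset.mem_filter]
    have := hP i (Finset.mem_range.1 hi)
    tauto
  have h2 := Finset.card_union_le ((Finset.range m).filter (fun i => Prefers (w i) a s) ∪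
      (Finset.range m).filter (fun i => Prefers (w i) b t)) ((Finset.range m).filter P)
  have h3 := Finset.card_union_le ((Finset.range m).filter (fun i => Prefers (w i) a s))
      ((Finset.range m).filter (fun i => Prefers (w i) b t))
  rw [Finset.card_range] at h1
  have h4 : k a + k b + k c = m + 1 := by
    rw [← hk]
    fin_cases a <;> fin_cases b <;> fin_cases c <;> simp at hab hac hbc ⊢ <;> omega
  omega

/-- If two pieces are not demanded even with the tolerance `t`, then the third one is demanded with
the margin `t`. -/
theorem demand_of_not_demand (hk : k 0 + k 1 + k 2 = m + 1) {a b c : Fin 3} (hab : a ≠ b)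
    (hac : a ≠ c) (hbc : b ≠ c) (ht : 0 ≤ t) (ha : ¬ Demand m k w a (-t))
    (hb : ¬ Demand m k w b (-t)) : Demand m k w c t := by
  classical
  refine le_card_of_not_demand hk hab hac hbc ha hb _ fun i _ h1 h2 => ?_
  simp only [Prefers, not_forall, not_le, exists_prop] at h1 h2
  obtain ⟨p, hp, hp'⟩ := h1
  obtain ⟨q, hq, hq'⟩ := h2
  have e1 : p = b ∨ p = c := by omega
  have e2 : q = a ∨ q = c := by omega
  intro l hl
  have e3 : l = a ∨ l = b := by omega
  rcases e1 with rfl | rfl <;> rcases e2 with rfl | rfl <;> rcases e3 with rfl | rfl <;> linarith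

/-- If piece `0` is worthless to everybody and piece `2` is not demanded with the margin `t`, then
piece `1` is demanded with the tolerance `t`. -/
theorem demand_one_of_zero_least (hk : k 0 + k 1 + k 2 = m + 1) (hk0 : 0 < k 0) (ht : 0 < t)
    (hw : ∀ i < m, ∀ l, w i 0 ≤ w i l) (h2 : ¬ Demand m k w 2 t) :
    ¬ Demand m k w 0 t ∧ Demand m k w 1 (-t) := by
  classical
  have h0 : ¬ Demand m k w 0 t := fun h => by
    obtain ⟨i, hi, hp⟩ := h.exists_prefers hk0
    linarith [hp 1 (by decide), hw i hi 1]
  refine ⟨h0, by_contra fun h1 => h2 ?_⟩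
  refine le_card_of_not_demand hk (by decide : (0 : Fin 3) ≠ 1) (by decide) (by decide) h0 h1 _
    fun i hi _ hp l hl => ?_
  simp only [Prefers, not_forall, not_le, exists_prop] at hp
  obtain ⟨p, hp, hp'⟩ := hp
  have a1 := hw i hi 1
  have e1 : p = 0 ∨ p = 2 := by omega
  have e2 : l = 0 ∨ l = 1 := by omega
  rcases e1 with rfl | rfl <;> rcases e2 with rfl | rfl <;> linarith

/-- If piece `1` is worthless to everybody and piece `2` is not demanded, then piece `0` is. -/
theorem demand_zero_of_one_least (hk : k 0 + k 1 + k 2 = m + 1) (hk1 : 0 < k 1)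
    (hw : ∀ i < m, ∀ l, w i 1 ≤ w i l) (h2 : ¬ Demand m k w 2 0) : Demand m k w 0 0 := by
  classical
  by_contra h0
  have h := le_card_of_not_demand hk (by decide : (0 : Fin 3) ≠ 2) (by decide : (0 : Fin 3) ≠ 1)
    (by decide) h0 h2 (fun _ => False) fun i hi h1 h2 => ?_
  · simp at h
    omega
  · have a0 := hw i hi 0
    have a2 := hw i hi 2
    simp only [Prefers, not_forall, not_le, exists_prop] at h1 h2
    obtain ⟨p, hp, hp'⟩ := h1
    obtain ⟨q, hq, hq'⟩ := h2
    have e1 : p = 1 ∨ p = 2 := by omega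
    have e2 : q = 0 ∨ q = 1 := by omega
    rcases e1 with rfl | rfl <;> rcases e2 with rfl | rfl <;> linarith

/-- The marriage theorem, with `k j` places at piece `j` and the last agent tied to piece `j₀`.
The hypotheses say that the number of the other agents for whom only `j` is acceptable is below
`k j`, and that at least `k j` of them accept `j`; this gives Hall's condition for sets of one and
of two pieces. -/
theorem exists_assignment (hk : k 0 + k 1 + k 2 = m + 1) (ht : 0 ≤ t)
    (hlo : ∀ j, Demand m k w j (-t)) (hhi : ∀ j, ¬ Demand m k w j t) (j₀ : Fin 3) :
    ∃ π : Fin (m + 1) → Fin 3, π (Fin.last m) = j₀ ∧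
      (∀ i : Fin (m + 1), i.val < m → ∀ j, w i j ≤ w i (π i) + t) ∧
      ∀ j, (Finset.univ.filter (fun i => π i = j)).card = k j := by
  classical
  let acc : Fin (m + 1) → Finset (Fin 3) := fun i =>
    if i.val < m then Finset.univ.filter (fun j => Prefers (w i) j (-t)) else {j₀}
  let T : Fin (m + 1) → Finset (Σ j : Fin 3, Fin (k j)) := fun i =>
    (acc i).sigma fun _ => Finset.univ
  have hcardT : ∀ J : Finset (Fin 3),
      (J.sigma fun j => (Finset.univ : Finset (Fin (k j)))).card = ∑ j ∈ J, k j := by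
    intro J
    simp
  have hsum : ∑ j, k j = m + 1 := by rw [Fin.sum_univ_three, hk]
  -- agents who accept nothing outside a proper set of pieces
  have hsub : ∀ J : Finset (Fin 3), J ≠ Finset.univ →
      ((Finset.range m).filter fun i => ∀ j, Prefers (w i) j (-t) → j ∈ J).card + 1
        ≤ ∑ j ∈ J, k j ∨ J = ∅ := by
    intro J hJ
    by_cases hJ0 : J = ∅
    · exact Or.inr hJ0
    left
    rcases (by revert J; decide : (∃ j, J = {j}) ∨ ∃ j, J = {j}ᶜ) with ⟨j, rfl⟩ | ⟨j, rfl⟩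
    · rw [Finset.sum_singleton]
      have h1 := hhi j
      rw [Demand, not_le] at h1
      refine lt_of_le_of_lt (Finset.card_le_card fun i hi => ?_) h1
      simp only [Finset.mem_filter, Finset.mem_singleton] at hi ⊢
      refine ⟨hi.1, fun l hl => ?_⟩
      -- the two other pieces are unacceptable, hence `j` beats the better one of them by `t`
      by_contra hcon
      push Not at hcon
      obtain ⟨p, -, hp⟩ := Finset.exists_max_image (Finset.univ : Finset (Fin 3)) (w i) ⟨0, by simp⟩
      have hpj : p = j := hi.2 p fun q _ => by linarith [hp q (by simp)]
      subst hpj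
      obtain ⟨q, hq, hq'⟩ : ∃ q, q ≠ l ∧ w i l < w i q - t := by
        by_contra hno
        push Not at hno
        exact hl (hi.2 l fun q hq => by linarith [hno q hq])
      linarith [hp q (by simp)]
    · have h1 := hlo j
      have h2 : ((Finset.range m).filter fun i =>
          ∀ l, Prefers (w i) l (-t) → l ∈ ({j}ᶜ : Finset _)).card +
          ((Finset.range m).filter fun i => Prefers (w i) j (-t)).card ≤ (Finset.range m).card := by
        rw [← Finset.card_union_of_disjoint]
        · exact Finset.card_le_card (Finset.union_subset (Finset.filter_subset _ _)
            (Finset.filter_subset _ _))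
        · refine Finset.disjoint_left.2 fun i hi hi' => ?_
          simp only [Finset.mem_filter, Finset.mem_compl, Finset.mem_singleton] at hi hi'
          exact hi.2 j hi'.2 rfl
      rw [Finset.card_range] at h2
      have h3 := Finset.sum_compl_add_sum {j} k
      rw [Finset.sum_singleton, hsum] at h3
      unfold Demand at h1
      omega
  have hall : ∀ S : Finset (Fin (m + 1)), S.card ≤ (S.biUnion T).card := by
    intro S
    have e : S.biUnion T = (S.biUnion acc).sigma fun _ => Finset.univ := by
      ext ⟨a, b⟩
      simp [T]
    rw [e, hcardT]
    by_cases hJ : S.biUnion acc = Finset.univ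
    · rw [hJ, hsum]
      simpa using Finset.card_le_univ S
    rcases hsub _ hJ with h | h
    · refine le_trans ?_ h
      rw [← Finset.card_image_of_injective S Fin.val_injective]
      refine le_trans (Finset.card_le_card (t := insert m _) fun i hi => ?_)
        (Finset.card_insert_le _ _)
      obtain ⟨i, hiS, rfl⟩ := Finset.mem_image.1 hi
      by_cases him : i.val < m
      · refine Finset.mem_insert_of_mem
          (Finset.mem_filter.2 ⟨Finset.mem_range.2 him, fun j hj => ?_⟩)
        exact Finset.mem_biUnion.2 ⟨i, hiS, by simp [acc, him, hj]⟩
      · have : i.val = m := by omega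
        simp [this]
    · have hS : S = ∅ := by
        by_contra hS
        obtain ⟨i, hi⟩ := Finset.nonempty_iff_ne_empty.2 hS
        have hacc : acc i = ∅ := Finset.subset_empty.1 (h ▸ Finset.subset_biUnion_of_mem acc hi)
        by_cases him : i.val < m
        · obtain ⟨p, -, hp⟩ :=
            Finset.exists_max_image (Finset.univ : Finset (Fin 3)) (w i) ⟨0, by simp⟩
          have : p ∈ acc i := by
            simp only [acc, him, if_true, Finset.mem_filter, Finset.mem_univ, true_and]
            exact fun q _ => by linarith [hp q (by simp)]
          simp [hacc] at this
        · simp [acc, him] at hacc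
      simp [hS]
  obtain ⟨f, hf, hfT⟩ := (Finset.all_card_le_biUnion_card_iff_exists_injective T).1 hall
  have hbij : Function.Bijective f := by
    rw [Fintype.bijective_iff_injective_and_card]
    refine ⟨hf, ?_⟩
    simp [hsum]
  have hmem : ∀ i, (f i).1 ∈ acc i := fun i => by
    have := hfT i
    simp only [T, Finset.mem_sigma] at this
    exact this.1
  refine ⟨fun i => (f i).1, ?_, fun i hi j => ?_, fun j => ?_⟩
  · simpa [acc] using hmem (Fin.last m)
  · have := hmem i
    simp only [acc, hi, if_true, Finset.mem_filter, Finset.mem_univ, true_and] at this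
    by_cases hj : j = (f i).1
    · subst hj
      exact le_add_of_nonneg_right ht
    · linarith [this j hj]
  · have h1 : (Finset.univ.filter (fun i => (f i).1 = j)).card
        = (Finset.univ.filter (fun x : Σ j : Fin 3, Fin (k j) => x.1 = j)).card :=
      Finset.card_bijective f hbij (by simp)
    rw [h1]
    have h2 : (Finset.univ.filter (fun x : Σ j : Fin 3, Fin (k j) => x.1 = j))
        = ({j} : Finset (Fin 3)).sigma fun _ => Finset.univ := by
      ext ⟨a, b⟩
      simp
    rw [h2, hcardT, Finset.sum_singleton]

end Demand

/-! ### Oracle values of the three pieces cut at `x` and `y` -/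

/-- The answers about the first `m` agents behave like monotone `K`-Lipschitz valuations of the
subintervals of `[0,1]` for which single points are worth least. -/
structure Oracle.Regular (O : Oracle) (m : ℕ) (K : ℝ) : Prop where
  mono : ∀ i < m, ∀ a b a' b', 0 ≤ a' → a' ≤ a → a ≤ b → b ≤ b' → b' ≤ 1 → O i a b ≤ O i a' b'
  lipschitz : ∀ i < m, ∀ a b a' b', 0 ≤ a → a ≤ b → b ≤ 1 → 0 ≤ a' → a' ≤ b' → b' ≤ 1 →
    |O i a b - O i a' b'| ≤ K * (|a - a'| + |b - b'|)
  point_le : ∀ i < m, ∀ a b c, 0 ≤ a → a ≤ 1 → 0 ≤ b → b ≤ c → c ≤ 1 → O i a a ≤ O i b c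

theorem Valuation.IsLipschitz.nonneg {K : ℝ} {v : Valuation} (h : v.IsLipschitz K) : 0 ≤ K := by
  have := h (Piece.interval 0 1 ⟨le_rfl, by norm_num, le_rfl⟩)
    (Piece.interval 0 0 ⟨le_rfl, le_rfl, by norm_num⟩)
  have e : (Piece.interval 0 1 ⟨le_rfl, by norm_num, le_rfl⟩).carrier ∆
      (Piece.interval 0 0 ⟨le_rfl, le_rfl, by norm_num⟩).carrier = Ioc (0 : ℝ) 1 := by
    ext z
    simp only [Piece.carrier, Piece.interval, mem_symmDiff, mem_Icc, mem_Ioc]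
    constructor
    · rintro (⟨h1, h2⟩ | ⟨h1, h2⟩)
      · exact ⟨lt_of_le_of_ne h1.1 fun h => h2 ⟨h1.1, h.symm.le⟩, h1.2⟩
      · exact absurd ⟨h1.1, h1.2.trans zero_le_one⟩ h2
    · rintro ⟨h1, h2⟩
      exact Or.inl ⟨⟨h1.le, h2⟩, fun h => absurd h.2 (not_le.2 h1)⟩
  rw [e, Real.volume_Ioc] at this
  simpa using (abs_nonneg _).trans this

theorem volume_symmDiff_Icc_le (a b a' b' : ℝ) :
    (volume (Icc a b ∆ Icc a' b')).toReal ≤ |a - a'| + |b - b'| := by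
  have hsub : Icc a b ∆ Icc a' b' ⊆ uIcc a a' ∪ uIcc b b' := by
    intro z hz
    simp only [mem_symmDiff, mem_Icc, mem_union, mem_uIcc] at hz ⊢
    by_contra hcon
    push Not at hcon
    grind
  have h1 : volume (Icc a b ∆ Icc a' b') ≤ ENNReal.ofReal (|a - a'| + |b - b'|) := by
    refine (measure_mono hsub).trans ((measure_union_le _ _).trans ?_)
    rw [Real.volume_interval, Real.volume_interval,
      ← ENNReal.ofReal_add (abs_nonneg _) (abs_nonneg _),
      abs_sub_comm a, abs_sub_comm b]
  exact ENNReal.toReal_le_of_le_ofReal (by positivity) h1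

theorem valueOracle_regular {n : ℕ} {K : ℝ} {v : Fin n → Valuation}
    (hm : ∀ i, (v i).IsMonotone) (hl : ∀ i, (v i).IsLipschitz K) :
    (valueOracle v).Regular (n - 1) K := by
  have hlip : ∀ i < n - 1, ∀ a b a' b', 0 ≤ a → a ≤ b → b ≤ 1 → 0 ≤ a' → a' ≤ b' → b' ≤ 1 →
      |valueOracle v i a b - valueOracle v i a' b'| ≤
        K * (volume (Icc a b ∆ Icc a' b')).toReal := by
    intro i hi a b a' b' h1 h2 h3 h4 h5 h6
    have hi' : i + 1 < n := by omega
    rw [valueOracle, valueOracle, dif_pos ⟨hi', h1, h2, h3⟩, dif_pos ⟨hi', h4, h5, h6⟩]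
    exact hl _ _ _
  have hmono : ∀ i < n - 1, ∀ a b a' b', 0 ≤ a' → a' ≤ a → a ≤ b → b ≤ b' → b' ≤ 1 →
      valueOracle v i a b ≤ valueOracle v i a' b' := by
    intro i hi a b a' b' h1 h2 h3 h4 h5
    have hi' : i + 1 < n := by omega
    rw [valueOracle, valueOracle, dif_pos ⟨hi', h1.trans h2, h3, h4.trans h5⟩,
      dif_pos ⟨hi', h1, (h2.trans h3).trans h4, h5⟩]
    exact hm _ _ _ (Icc_subset_Icc h2 h4)
  refine ⟨hmono, fun i hi a b a' b' h1 h2 h3 h4 h5 h6 => ?_, fun i hi a b c h1 h2 h3 h4 h5 => ?_⟩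
  · refine (hlip i hi a b a' b' h1 h2 h3 h4 h5 h6).trans ?_
    have hK : 0 ≤ K := (hl ⟨i, by omega⟩).nonneg
    exact mul_le_mul_of_nonneg_left (volume_symmDiff_Icc_le _ _ _ _) hK
  · -- points have the same value because they differ by a null set
    have h := hlip i hi a a b b h1 le_rfl h2 h3 le_rfl (h4.trans h5)
    have h0 : volume (Icc a a ∆ Icc b b) = 0 := by
      refine measure_mono_null (t := {a} ∪ {b}) ?_ (by
        rw [measure_union_null_iff]
        exact ⟨Real.volume_singleton, Real.volume_singleton⟩)
      rw [Icc_self, Icc_self]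
      exact symmDiff_le_sup (α := Set ℝ)
    rw [h0, ENNReal.toReal_zero, mul_zero] at h
    have := abs_le.1 h
    linarith [hmono i hi b b b c h3 le_rfl le_rfl h4 h5]

/-- The values of the pieces `[0,x]`, `[x,y]`, `[y,1]` to agent `i`. -/
def cutValue (O : Oracle) (x y : ℝ) (i : ℕ) : Fin 3 → ℝ := ![O i 0 x, O i x y, O i y 1]

section CutValue

variable {O : Oracle} {m : ℕ} {k : Fin 3 → ℕ} {K : ℝ} {j : Fin 3} {s t x x' y y' : ℝ}

theorem cutValue_perturb (hO : O.Regular m K) (hK : 0 ≤ K) (hx : 0 ≤ x) (hxy : x ≤ y) (hy : y ≤ 1)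
    (hx' : 0 ≤ x') (hxy' : x' ≤ y') (hy' : y' ≤ 1) :
    ∀ i < m, ∀ l, |cutValue O x y i l - cutValue O x' y' i l| ≤ K * (|x - x'| + |y - y'|) := by
  intro i hi l
  have h0 := mul_nonneg hK (abs_nonneg (x - x'))
  have h1 := mul_nonneg hK (abs_nonneg (y - y'))
  fin_cases l
  · refine (hO.lipschitz i hi 0 x 0 x' le_rfl hx (hxy.trans hy) le_rfl hx'
      (hxy'.trans hy')).trans ?_
    rw [sub_self, abs_zero, zero_add]
    linarith
  · exact hO.lipschitz i hi x y x' y' hx hxy hy hx' hxy' hy'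
  · refine (hO.lipschitz i hi y 1 y' 1 (hx.trans hxy) hy le_rfl (hx'.trans hxy') hy'
      le_rfl).trans ?_
    rw [sub_self, abs_zero, add_zero]
    linarith

/-- Moving the second cut to the left makes piece `2` more attractive. -/
theorem Demand.move_left (hO : O.Regular m K) (hx : 0 ≤ x) (hxy : x ≤ y) (hyy : y ≤ y')
    (hy' : y' ≤ 1) (h : Demand m k (cutValue O x y') 2 t) : Demand m k (cutValue O x y) 2 t := by
  refine h.imp fun i hi hp l hl => ?_
  have h2 := hO.mono i hi y' 1 y 1 (hx.trans hxy) hyy hy' le_rfl le_rfl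
  have h1 := hO.mono i hi x y x y' hx le_rfl hxy hyy hy'
  have h3 := hp l hl
  have e : l = 0 ∨ l = 1 := by omega
  rcases e with rfl | rfl <;> simp [cutValue] at h3 ⊢ <;> linarith

theorem cutValue_one_least (hO : O.Regular m K) (hx : 0 ≤ x) (hx1 : x ≤ 1) :
    ∀ i < m, ∀ l, cutValue O x x i 1 ≤ cutValue O x x i l := by
  intro i hi l
  fin_cases l
  · exact hO.point_le i hi _ _ _ hx hx1 le_rfl hx hx1
  · exact le_rfl
  · exact hO.point_le i hi _ _ _ hx hx1 hx hx1 le_rfl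

theorem cutValue_zero_least (hO : O.Regular m K) (hy : 0 ≤ y) (hy1 : y ≤ 1) :
    ∀ i < m, ∀ l, cutValue O 0 y i 0 ≤ cutValue O 0 y i l := by
  intro i hi l
  fin_cases l
  · exact le_rfl
  · exact hO.point_le i hi _ _ _ le_rfl zero_le_one le_rfl hy hy1
  · exact hO.point_le i hi _ _ _ le_rfl zero_le_one hy hy1 le_rfl

theorem cutValue_two_least (hO : O.Regular m K) (hx : 0 ≤ x) (hx1 : x ≤ 1) :
    ∀ i < m, ∀ l, cutValue O x 1 i 2 ≤ cutValue O x 1 i l := by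
  intro i hi l
  fin_cases l
  · exact hO.point_le i hi _ _ _ zero_le_one le_rfl le_rfl hx hx1
  · exact hO.point_le i hi _ _ _ zero_le_one le_rfl hx hx1 le_rfl
  · exact le_rfl

end CutValue

theorem not_demand_of_least {m : ℕ} {k : Fin 3 → ℕ} {w : ℕ → Fin 3 → ℝ} {t : ℝ} {j : Fin 3}
    (hk : 0 < k j) (hw : ∀ i < m, ∀ l, w i j ≤ w i l) (ht : 0 < t) : ¬ Demand m k w j t := by
  intro h
  obtain ⟨i, hi, hp⟩ := h.exists_prefers hk
  have : j + 1 ≠ j := by omega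
  linarith [hp _ this, hw i hi (j + 1)]

/-! ### Labels of cut points -/

/-- The point `(x, y)` lies approximately on the curve where exactly the right number of agents
demand piece `2`. Where `x` is so large that no `y` makes piece `2` attractive enough, the curve
follows the diagonal `y = x`. -/
structure OnCurve (O : Oracle) (m : ℕ) (k : Fin 3 → ℕ) (η x y : ℝ) : Prop where
  nonneg : 0 ≤ x
  le : x ≤ y
  le_one : y ≤ 1
  demand : Demand m k (cutValue O x y) 2 0 ∨ y = x
  not_demand : ¬ Demand m k (cutValue O x y) 2 η

/-- Piece `0` is not yet too attractive, piece `1` still is attractive enough. -/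
def LeftLabel (O : Oracle) (m : ℕ) (k : Fin 3 → ℕ) (t x y : ℝ) : Prop :=
  ¬ Demand m k (cutValue O x y) 0 t ∧ Demand m k (cutValue O x y) 1 (-t)

/-- Piece `0` already is attractive enough, piece `1` is no longer too attractive. -/
def RightLabel (O : Oracle) (m : ℕ) (k : Fin 3 → ℕ) (t x y : ℝ) : Prop :=
  Demand m k (cutValue O x y) 0 (-t) ∧ ¬ Demand m k (cutValue O x y) 1 t

section Label

variable {O : Oracle} {m : ℕ} {k : Fin 3 → ℕ} {K δ η s t x y x' y' : ℝ}

/-- Wherever the demand for piece `2` is about right, one of the two labels applies. -/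
theorem rightLabel_of_not_leftLabel (hk : k 0 + k 1 + k 2 = m + 1) (ht : 0 < t) (hs : -t < s)
    (hlo : Demand m k (cutValue O x y) 2 s) (hhi : ¬ Demand m k (cutValue O x y) 2 t)
    (h : ¬ LeftLabel O m k t x y) : RightLabel O m k t x y := by
  by_cases h0 : Demand m k (cutValue O x y) 0 t
  · refine ⟨h0.anti (by linarith), fun h1 => ?_⟩
    refine not_forall_demand hk ![t, t, s] ?_ (fun j => ?_) (w := cutValue O x y)
    · intro a b hab
      fin_cases a <;> fin_cases b <;> simp at hab ⊢ <;> linarith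
    · fin_cases j
      exacts [h0, h1, hlo]
  · have h1 : ¬ Demand m k (cutValue O x y) 1 (-t) := fun h1 => h ⟨h0, h1⟩
    refine ⟨by_contra fun h2 => hhi ?_, fun h2 => h1 (h2.anti (by linarith))⟩
    exact demand_of_not_demand hk (by decide : (0 : Fin 3) ≠ 1) (by decide) (by decide) ht.le h2 h1

theorem OnCurve.rightLabel (hO : O.Regular m K) (hk : k 0 + k 1 + k 2 = m + 1)
    (hk' : ∀ j, 0 < k j) (hη : 0 < η) (hc : OnCurve O m k η x y)
    (h : ¬ (Demand m k (cutValue O x y) 2 0 ∧ LeftLabel O m k η x y)) :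
    RightLabel O m k η x y := by
  by_cases h2 : Demand m k (cutValue O x y) 2 0
  · exact rightLabel_of_not_leftLabel hk hη (by linarith) h2 hc.not_demand fun h' => h ⟨h2, h'⟩
  · obtain rfl : y = x := hc.demand.resolve_left h2
    have hw := cutValue_one_least hO hc.nonneg hc.le_one
    exact ⟨(demand_zero_of_one_least hk (hk' 1) hw h2).anti (by linarith),
      not_demand_of_least (hk' 1) hw hη⟩

/-- The curve starts, at `x = 0`, in a point with a left label. -/
theorem OnCurve.leftLabel_zero (hO : O.Regular m K) (hk : k 0 + k 1 + k 2 = m + 1)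
    (hk' : ∀ j, 0 < k j) (hη : 0 < η) (hc : OnCurve O m k η 0 y) :
    Demand m k (cutValue O 0 y) 2 0 ∧ LeftLabel O m k η 0 y := by
  refine ⟨?_, demand_one_of_zero_least hk (hk' 0) hη (cutValue_zero_least hO hc.le hc.le_one)
    hc.not_demand⟩
  rcases hc.demand with h | rfl
  · exact h
  · -- at `x = y = 0` piece `2` is the whole cake
    have h0 := hk' 0
    have h1 := hk' 1
    refine demand_of_forall (by omega) fun i hi l hl => ?_
    have e : l = 0 ∨ l = 1 := by omega
    have := hO.mono i hi 0 0 0 1 le_rfl le_rfl le_rfl zero_le_one le_rfl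
    rcases e with rfl | rfl <;> simpa [cutValue] using this

/-- The curve ends, at `x = y = 1`, in a point with a right label. -/
theorem onCurve_one (hO : O.Regular m K) (hk' : ∀ j, 0 < k j) (hη : 0 < η) :
    OnCurve O m k η 1 1 :=
  ⟨zero_le_one, le_rfl, le_rfl, Or.inr rfl,
    not_demand_of_least (hk' 2) (cutValue_two_least hO zero_le_one le_rfl) hη⟩

theorem rightLabel_one (hO : O.Regular m K) (hk : k 0 + k 1 + k 2 = m + 1) (hk' : ∀ j, 0 < k j)
    (hη : 0 < η) : RightLabel O m k η 1 1 := by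
  have h1 := hk' 1
  have h2 := hk' 2
  have hw1 := cutValue_one_least hO zero_le_one le_rfl
  have hw2 := cutValue_two_least hO zero_le_one le_rfl
  refine ⟨demand_of_forall (by omega) fun i hi l hl => ?_, not_demand_of_least h1 hw1 hη⟩
  have e : l = 1 ∨ l = 2 := by omega
  rcases e with rfl | rfl
  · linarith [hw1 i hi 0]
  · linarith [hw2 i hi 0]

/-- The last bisection takes place in one column, between two points where the demand for piece `2`
is about right and which carry different labels. -/
structure Bracket (O : Oracle) (m : ℕ) (k : Fin 3 → ℕ) (η x a b : ℝ) : Prop where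
  left_mem : x ≤ a ∧ a ≤ 1
  right_mem : x ≤ b ∧ b ≤ 1
  demand_left : Demand m k (cutValue O x a) 2 (-η)
  demand_right : Demand m k (cutValue O x b) 2 (-η)
  not_demand_left : ¬ Demand m k (cutValue O x a) 2 (2 * η)
  not_demand_right : ¬ Demand m k (cutValue O x b) 2 (2 * η)
  left : LeftLabel O m k (2 * η) x a
  right : RightLabel O m k (2 * η) x b

theorem OnCurve.bracket (hO : O.Regular m K) (hK : 0 ≤ K) (hδ : 0 < δ)
    (hη : η = 3 * δ)
    (hl : OnCurve O m k η x y) (hr : OnCurve O m k η x' y')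
    (hxx : x ≤ x') (hgap : K * (x' - x) ≤ δ) (hl2 : Demand m k (cutValue O x y) 2 0)
    (hleft : LeftLabel O m k η x y) (hright : RightLabel O m k η x' y') :
    Bracket O m k η x y y' := by
  have hxy' : x ≤ y' := hxx.trans hr.le
  have hp : ∀ i < m, ∀ l, |cutValue O x' y' i l - cutValue O x y' i l| ≤ δ := fun i hi l => by
    refine (cutValue_perturb hO hK hr.nonneg hr.le hr.le_one hl.nonneg hxy' hr.le_one
      i hi l).trans ?_
    rwa [sub_self, abs_zero, add_zero, abs_of_nonneg (by linarith)]
  have hp' : ∀ i < m, ∀ l, |cutValue O x y' i l - cutValue O x' y' i l| ≤ δ := fun i hi l => by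
    rw [abs_sub_comm]
    exact hp i hi l
  refine ⟨⟨hl.le, hl.le_one⟩, ⟨hxy', hr.le_one⟩, hl2.anti (by linarith), ?_,
    fun h => hl.not_demand (h.anti (by linarith)),
    fun h => hr.not_demand (h.perturb hp' (by linarith)),
    ⟨fun h => hleft.1 (h.anti (by linarith)), hleft.2.anti (by linarith)⟩,
    hright.1.perturb hp (by linarith), fun h => hright.2 (h.perturb hp' (by linarith))⟩
  rcases hr.demand with h | h
  · exact h.perturb hp (by linarith)
  · rcases le_total y y' with hyy | hyy
    · -- `x ≤ y ≤ y' = x'`, so that the second cut moves by at most `x' - x`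
      refine hl2.perturb (d := δ) (fun i hi l => ?_) (by linarith)
      refine (cutValue_perturb hO hK hl.nonneg hl.le hl.le_one hl.nonneg hxy' hr.le_one
        i hi l).trans ?_
      rw [sub_self, abs_zero, zero_add, abs_of_nonpos (by linarith)]
      refine le_trans (mul_le_mul_of_nonneg_left ?_ hK) hgap
      linarith [hl.le]
    · exact (hl2.move_left hO hl.nonneg hxy' hyy hl.le_one).anti (by linarith)

/-- The demand for piece `2` stays about right between the ends of a bracket. -/
theorem Bracket.demand_mid (hO : O.Regular m K) (hx : 0 ≤ x) {a b c : ℝ}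
    (h : Bracket O m k η x a b) (hc : c = (a + b) / 2) :
    (x ≤ c ∧ c ≤ 1) ∧ Demand m k (cutValue O x c) 2 (-η) ∧
      ¬ Demand m k (cutValue O x c) 2 (2 * η) := by
  have h1 := h.left_mem
  have h2 := h.right_mem
  refine ⟨⟨by linarith, by linarith⟩, ?_⟩
  rcases le_total a b with hab | hab
  · exact ⟨h.demand_right.move_left hO hx (by linarith) (by linarith) h2.2,
      fun h' => h.not_demand_left (h'.move_left hO hx h1.1 (by linarith) (by linarith))⟩
  · exact ⟨h.demand_left.move_left hO hx (by linarith) (by linarith) h1.2,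
      fun h' => h.not_demand_right (h'.move_left hO hx h2.1 (by linarith) (by linarith))⟩

theorem Bracket.mid_left (hO : O.Regular m K) (hx : 0 ≤ x) {a b c : ℝ}
    (h : Bracket O m k η x a b) (hc : c = (a + b) / 2) (hl : LeftLabel O m k (2 * η) x c) :
    Bracket O m k η x c b := by
  obtain ⟨h1, h2, h3⟩ := h.demand_mid hO hx hc
  exact ⟨h1, h.right_mem, h2, h.demand_right, h3, h.not_demand_right, hl, h.right⟩

theorem Bracket.mid_right (hO : O.Regular m K) (hk : k 0 + k 1 + k 2 = m + 1) (hx : 0 ≤ x)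
    (hη : 0 < η) {a b c : ℝ} (h : Bracket O m k η x a b) (hc : c = (a + b) / 2)
    (hl : ¬ LeftLabel O m k (2 * η) x c) : Bracket O m k η x a c := by
  obtain ⟨h1, h2, h3⟩ := h.demand_mid hO hx hc
  exact ⟨h.left_mem, h1, h.demand_left, h2, h.not_demand_left, h3, h.left,
    rightLabel_of_not_leftLabel hk (by linarith) (by linarith) h2 h3 hl⟩

/-- A narrow bracket gives a cut point at which all three demands are right up to `8 δ`. -/
theorem Bracket.solution (hO : O.Regular m K) (hK : 0 ≤ K) (hδ : 0 < δ) (hη : η = 3 * δ)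
    (hx : 0 ≤ x) {a b : ℝ} (h : Bracket O m k η x a b) (hgap : K * |a - b| ≤ δ) (j : Fin 3) :
    Demand m k (cutValue O x a) j (-(8 * δ)) ∧ ¬ Demand m k (cutValue O x a) j (8 * δ) := by
  have h1 := h.left_mem
  have h2 := h.right_mem
  have hp : ∀ i < m, ∀ l, |cutValue O x a i l - cutValue O x b i l| ≤ δ := fun i hi l => by
    refine (cutValue_perturb hO hK hx h1.1 h1.2 hx h2.1 h2.2 i hi l).trans ?_
    rwa [sub_self, abs_zero, zero_add]
  have hp' : ∀ i < m, ∀ l, |cutValue O x b i l - cutValue O x a i l| ≤ δ := fun i hi l => by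
    rw [abs_sub_comm]
    exact hp i hi l
  fin_cases j
  · exact ⟨h.right.1.perturb hp' (by linarith), fun h' => h.left.1 (h'.anti (by linarith))⟩
  · exact ⟨h.left.2.anti (by linarith), fun h' => h.right.2 (h'.perturb hp (by linarith))⟩
  · exact ⟨h.demand_left.anti (by linarith),
      fun h' => h.not_demand_left (h'.anti (by linarith))⟩

end Label

/-! ### Running programs with a time bound -/

@[simp] theorem Store.setReal_real (s : Store) (d r : ℕ) (x : ℝ) :
    (s.setReal d x).real r = if r = d then x else s.real r := by
  simp [Store.setReal, Function.update_apply]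

@[simp] theorem Store.setReal_nat (s : Store) (d r : ℕ) (x : ℝ) :
    (s.setReal d x).nat r = s.nat r := rfl

@[simp] theorem Store.setNat_nat (s : Store) (d r x : ℕ) :
    (s.setNat d x).nat r = if r = d then x else s.nat r := by
  simp [Store.setNat, Function.update_apply]

@[simp] theorem Store.setNat_real (s : Store) (d r x : ℕ) :
    (s.setNat d x).real r = s.real r := rfl

/-- Started in `s`, the program halts within `T` time units in a store with the property `Q`. -/
def Runs (O : Oracle) (p : Program) (s : Store) (T : ℕ) (Q : Store → Prop) : Prop :=
  ∃ s' t, Exec O p s s' t ∧ t ≤ T ∧ Q s'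

/-- A list of instructions followed by a program. -/
def block (l : List Instr) (p : Program) : Program := l.foldr (fun c q => .seq (.instr c) q) p

section Runs

variable {O : Oracle} {p q : Program} {s : Store} {T T' T₁ T₂ : ℕ} {Q R : Store → Prop} {b : Test}

theorem Runs.mono (h : Runs O p s T Q) (hT : T ≤ T') (hQ : ∀ s', Q s' → R s') :
    Runs O p s T' R := by
  obtain ⟨s', t, h1, h2, h3⟩ := h
  exact ⟨s', t, h1, h2.trans hT, hQ _ h3⟩

theorem runs_skip (h : Q s) : Runs O .skip s 1 Q := ⟨s, 1, .skip s, le_rfl, h⟩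

theorem runs_instr {c : Instr} (h : Q (c.apply O s)) : Runs O (.instr c) s 1 Q :=
  ⟨_, 1, .instr c s, le_rfl, h⟩

theorem Runs.seq (h : Runs O p s T₁ R) (h' : ∀ s', R s' → Runs O q s' T₂ Q) :
    Runs O (.seq p q) s (T₁ + T₂) Q := by
  obtain ⟨s₁, t₁, e₁, l₁, r₁⟩ := h
  obtain ⟨s₂, t₂, e₂, l₂, r₂⟩ := h' _ r₁
  exact ⟨s₂, t₁ + t₂, .seq e₁ e₂, by omega, r₂⟩

theorem runs_block {l : List Instr}
    (h : Runs O p (l.foldl (fun s c => c.apply O s) s) T Q) :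
    Runs O (block l p) s (T + l.length) Q := by
  induction l generalizing s with
  | nil => exact h
  | cons c l ih =>
    refine ((runs_instr (Q := fun s' => s' = c.apply O s) rfl).seq
      (T₂ := T + l.length) ?_).mono (by simp; omega) fun _ h => h
    rintro s' rfl
    exact ih h

theorem runs_ite (h : b.Holds s → Runs O p s T Q) (h' : ¬ b.Holds s → Runs O q s T Q) :
    Runs O (.ite b p q) s (T + 1) Q := by
  by_cases hb : b.Holds s
  · obtain ⟨s', t, e, l, r⟩ := h hb
    exact ⟨s', t + 1, .iteTrue hb e, by omega, r⟩
  · obtain ⟨s', t, e, l, r⟩ := h' hb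
    exact ⟨s', t + 1, .iteFalse hb e, by omega, r⟩

/-- A loop with an invariant `I f`, where `f` bounds the number of iterations still to come. -/
theorem runs_loop (I : ℕ → Store → Prop) (hdone : ∀ s, I 0 s → ¬ b.Holds s)
    (hbody : ∀ f s, I (f + 1) s → b.Holds s → Runs O p s T (I f)) (f : ℕ) (h : I f s) :
    Runs O (.loop b p) s (f * (T + 1) + 1) fun s' => ¬ b.Holds s' ∧ ∃ f', I f' s' := by
  induction f generalizing s with
  | zero => exact ⟨s, 1, .loopFalse (hdone s h), by simp, hdone s h, 0, h⟩
  | succ f ih =>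
    by_cases hb : b.Holds s
    · obtain ⟨s₁, t₁, e₁, l₁, r₁⟩ := hbody f s h hb
      obtain ⟨s₂, t₂, e₂, l₂, r₂⟩ := ih r₁
      refine ⟨s₂, t₁ + t₂ + 1, .loopTrue hb e₁ e₂, ?_, r₂⟩
      rw [Nat.succ_mul]
      omega
    · exact ⟨s, 1, .loopFalse hb, by omega, hb, _, h⟩

/-- A loop that halves a real register until it is at most `δ`. -/
theorem runs_halving {g d N : ℕ} {δ : ℝ} (I : Store → Prop) (hd : ∀ s, I s → s.real d = δ)
    (hbody : ∀ s, I s → Runs O p s T fun s' => I s' ∧ s'.real g = s.real g / 2)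
    (h : I s) (hN : s.real g ≤ 2 ^ N * δ) :
    Runs O (.loop (.realLt d g) p) s (N * (T + 1) + 1) fun s' => I s' ∧ s'.real g ≤ δ := by
  refine (runs_loop (fun f s => I s ∧ s.real g ≤ 2 ^ f * δ) (fun s h => ?_) (fun f s h _ => ?_)
    N ⟨h, hN⟩).mono le_rfl ?_
  · simpa [Test.Holds, hd s h.1] using h.2
  · refine (hbody s h.1).mono le_rfl fun s' h' => ⟨h'.1, ?_⟩
    have := h.2
    rw [pow_succ] at this
    linarith [h'.2]
  · rintro s' ⟨h1, f, h2, -⟩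
    refine ⟨h2, ?_⟩
    simpa [Test.Holds, hd s' h2] using h1

end Runs

/-- The registers below `c` are the same in both stores. -/
def Agree (c : ℕ) (s s' : Store) : Prop :=
  (∀ r < c, s'.nat r = s.nat r) ∧ ∀ r < c, s'.real r = s.real r

theorem Agree.refl (c : ℕ) (s : Store) : Agree c s s := ⟨fun _ _ => rfl, fun _ _ => rfl⟩

theorem Agree.trans {c c' : ℕ} {s s' s'' : Store} (h : Agree c s s') (h' : Agree c' s' s'')
    (hc : c ≤ c') : Agree c s s'' :=
  ⟨fun r hr => (h'.1 r (hr.trans_le hc)).trans (h.1 r hr),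
    fun r hr => (h'.2 r (hr.trans_le hc)).trans (h.2 r hr)⟩

theorem Agree.setReal {c d : ℕ} {s s' : Store} (h : Agree c s s') (hd : c ≤ d) (x : ℝ) :
    Agree c s (s'.setReal d x) :=
  ⟨h.1, fun r hr => by simp [(hr.trans_le hd).ne, h.2 r hr]⟩

theorem Agree.setNat {c d : ℕ} {s s' : Store} (h : Agree c s s') (hd : c ≤ d) (x : ℕ) :
    Agree c s (s'.setNat d x) :=
  ⟨fun r hr => by simp [(hr.trans_le hd).ne, h.1 r hr], h.2⟩

/-- The parameters of the instance and the constants are in their registers. -/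
structure Env (m : ℕ) (k : Fin 3 → ℕ) (K δ : ℝ) (s : Store) : Prop where
  size : ∀ j : Fin 3, s.nat (j.val + 1) = k j
  agents : s.nat 4 = m
  natOne : s.nat 5 = 1
  lip : s.real 0 = K
  acc : s.real 2 = δ
  zero : s.real 3 = 0
  one : s.real 4 = 1
  half : s.real 8 = 1 / 2

section Env

variable {O : Oracle} {m : ℕ} {k : Fin 3 → ℕ} {K δ η : ℝ} {s s' : Store} {T N : ℕ}
  {Q : Store → Prop}

theorem Env.agree (h : Env m k K δ s) {c : ℕ} (hs : Agree c s s') (hc : 9 ≤ c) :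
    Env m k K δ s' where
  size j := by rw [hs.1 _ (by omega), h.size]
  agents := by rw [hs.1 _ (by omega), h.agents]
  natOne := by rw [hs.1 _ (by omega), h.natOne]
  lip := by rw [hs.2 _ (by omega), h.lip]
  acc := by rw [hs.2 _ (by omega), h.acc]
  zero := by rw [hs.2 _ (by omega), h.zero]
  one := by rw [hs.2 _ (by omega), h.one]
  half := by rw [hs.2 _ (by omega), h.half]

theorem Env.setReal (h : Env m k K δ s) {d : ℕ} (hd : d ∉ [0, 2, 3, 4, 8]) (x : ℝ) :
    Env m k K δ (s.setReal d x) := by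
  simp only [List.mem_cons, List.not_mem_nil, or_false, not_or] at hd
  obtain ⟨h0, h2, h3, h4, h8⟩ := hd
  refine ⟨h.size, h.agents, h.natOne, ?_, ?_, ?_, ?_, ?_⟩
  · simp [Ne.symm h0, h.lip]
  · simp [Ne.symm h2, h.acc]
  · simp [Ne.symm h3, h.zero]
  · simp [Ne.symm h4, h.one]
  · simp [Ne.symm h8, h.half]

/-! ### Counting the agents that demand a piece

Real registers `13` and `14` hold the cuts `x` and `y`; registers from `20` on are scratch. -/

/-- Inspect the agent in natural number register `20`: if it prefers piece `j` by the margin in real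
register `τ`, increase the counter, natural number register `21`. Then go on to the next agent. -/
def countStep (j : Fin 3) (τ : ℕ) : Program :=
  block [.query 20 20 3 13, .query 21 20 13 14, .query 22 20 14 4,
      .realAdd 23 (20 + (j + 1).val) τ, .realAdd 24 (20 + (j + 2).val) τ, .natAdd 20 20 5]
    (.ite (.realLe 23 (20 + j.val))
      (.ite (.realLe 24 (20 + j.val)) (.instr (.natAdd 21 21 5)) .skip) .skip)

/-- Run `p` if piece `j` is demanded with the margin in real register `τ`, otherwise `q`. -/
def demandTest (j : Fin 3) (τ : ℕ) (p q : Program) : Program :=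
  block [.natConst 20 0, .natConst 21 0]
    (.seq (.loop (.natLt 20 4) (countStep j τ)) (.ite (.natLt 21 (j.val + 1)) q p))

theorem prefers_iff (w : Fin 3 → ℝ) (j : Fin 3) (t : ℝ) :
    Prefers w j t ↔ w (j + 1) + t ≤ w j ∧ w (j + 2) + t ≤ w j := by
  constructor
  · intro h
    exact ⟨h _ (by omega), h _ (by omega)⟩
  · rintro ⟨h1, h2⟩ l hl
    have : l = j + 1 ∨ l = j + 2 := by omega
    rcases this with rfl | rfl <;> assumption

open Classical in
theorem runs_countStep (h : Env m k K δ s) {τ : ℕ} (hτ : τ < 20) (j : Fin 3) :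
    Runs O (countStep j τ) s 9 fun s' => Agree 20 s s' ∧ s'.nat 20 = s.nat 20 + 1 ∧
      s'.nat 21 = s.nat 21 +
        if Prefers (cutValue O (s.real 13) (s.real 14) (s.nat 20)) j (s.real τ) then 1 else 0 := by
  have hτ' : τ ≠ 20 ∧ τ ≠ 21 ∧ τ ≠ 22 ∧ τ ≠ 23 := by omega
  rw [prefers_iff]
  refine runs_block (T := 3) (runs_ite (fun h1 => runs_ite (fun h2 => runs_instr ?_)
    fun h2 => runs_skip ?_) fun h1 => (runs_skip ?_).mono (by norm_num) fun _ h => h)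
  all_goals
    refine ⟨by
      simp only [List.foldl, Instr.apply]
      repeat' first | exact Agree.refl _ _ | apply Agree.setReal | apply Agree.setNat
      all_goals norm_num, ?_, ?_⟩
    · fin_cases j <;> simp [Instr.apply, h.natOne]
  · rw [if_pos]
    · simp [Instr.apply, h.natOne]
    · fin_cases j <;> simp [Instr.apply, Test.Holds, cutValue, h.zero, h.one, hτ'] at h1 h2 ⊢ <;>
        exact ⟨h1, h2⟩
  · rw [if_neg]
    · simp [Instr.apply, h.natOne]
    · fin_cases j <;> simp [Instr.apply, Test.Holds, cutValue, h.zero, h.one, hτ'] at h1 h2 ⊢ <;>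
        exact fun _ => h2
  · rw [if_neg]
    · simp [Instr.apply, h.natOne]
    · fin_cases j <;> simp [Instr.apply, Test.Holds, cutValue, h.zero, h.one, hτ'] at h1 ⊢ <;>
        exact fun h' => absurd h' (not_le.2 h1)

theorem runs_demandTest (h : Env m k K δ s) {τ : ℕ} (hτ : τ < 20) (j : Fin 3) {p q : Program}
    (hp : Demand m k (cutValue O (s.real 13) (s.real 14)) j (s.real τ) →
      ∀ s', Agree 20 s s' → Runs O p s' T Q)
    (hq : ¬ Demand m k (cutValue O (s.real 13) (s.real 14)) j (s.real τ) →
      ∀ s', Agree 20 s s' → Runs O q s' T Q) :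
    Runs O (demandTest j τ p q) s (10 * m + 4 + T) Q := by
  classical
  set w := cutValue O (s.real 13) (s.real 14) with hw
  refine (runs_block (T := (m * (9 + 1) + 1) + (T + 1)) (Runs.seq (runs_loop
    (fun f s' => Agree 20 s s' ∧ s'.nat 20 + f = m ∧ s'.nat 21 =
      ((Finset.range (s'.nat 20)).filter (fun i => Prefers (w i) j (s.real τ))).card)
    (fun s' hs' => ?_) (fun f s' hs' _ => ?_) m ?_) ?_)).mono (by simp; omega) fun _ h => h
  · have := (h.agree hs'.1 (by norm_num)).agents
    simp only [Test.Holds]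
    omega
  · obtain ⟨h1, h2, h3⟩ := hs'
    refine (runs_countStep (h.agree h1 (by norm_num)) hτ j).mono le_rfl fun s'' hs'' => ?_
    obtain ⟨h4, h5, h6⟩ := hs''
    refine ⟨h1.trans h4 le_rfl, by omega, ?_⟩
    rw [h6, h5, h3, Finset.range_add_one, Finset.filter_insert, h1.2 _ (by norm_num : 13 < 20),
      h1.2 _ (by norm_num : 14 < 20), h1.2 _ hτ, ← hw]
    split_ifs
    · rw [Finset.card_insert_of_notMem (by simp)]
    · rfl
  · refine ⟨?_, ?_, ?_⟩
    · exact ((Agree.refl 20 s).setNat le_rfl 0).setNat (by norm_num) 0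
    · simp [Instr.apply]
    · simp [Instr.apply]
  · rintro s' ⟨hb, f, h1, h2, h3⟩
    have he := h.agree h1 (by norm_num)
    have hi : s'.nat 20 = m := by
      have := he.agents
      simp only [Test.Holds] at hb
      omega
    rw [hi] at h3
    have key : (Test.natLt 21 (j.val + 1)).Holds s' ↔ ¬ Demand m k w j (s.real τ) := by
      rw [Demand, not_le, Test.Holds, he.size, h3]
    refine runs_ite (fun hb => hq (key.1 hb) s' h1) fun hb => hp ?_ s' h1
    by_contra hcon
    exact hb (key.2 hcon)

end Env

section Search

variable {O : Oracle} {m : ℕ} {k : Fin 3 → ℕ} {K δ η : ℝ} {s s' : Store} {T N : ℕ}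
  {Q : Store → Prop}

/-! ### Bisection for the second cut -/

/-- One step of the bisection for the second cut between registers `15` and `16`. -/
def curveStep : Program :=
  block [.realAdd 14 15 16, .realMul 14 14 8]
    (.seq (demandTest 2 3 (.instr (.realCopy 15 14)) (.instr (.realCopy 16 14)))
      (.instr (.realMul 17 17 8)))

/-- For the first cut `x` in register `13`, find `y` such that `(x, y)` is on the curve, and put it
into register `14`. Register `17` holds a bound for `K` times the length of the interval that
contains `y`. -/
def findCurve : Program :=
  block [.realCopy 15 13, .realCopy 16 4, .realCopy 17 0]
    (.seq (.loop (.realLt 2 17) curveStep) (.instr (.realCopy 14 15)))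

/-- Invariant of the bisection for the second cut between `a` and `b`. -/
structure CurveInv (O : Oracle) (m : ℕ) (k : Fin 3 → ℕ) (x a b : ℝ) : Prop where
  le_left : x ≤ a
  le : a ≤ b
  right_le : b ≤ 1
  left : Demand m k (cutValue O x a) 2 0 ∨ a = x
  right : ∀ t, 0 < t → ¬ Demand m k (cutValue O x b) 2 t

theorem CurveInv.onCurve (hO : O.Regular m K) (hK : 0 ≤ K) (hδ : 0 < δ) (hη : η = 3 * δ)
    {x a b : ℝ} (hx : 0 ≤ x) (h : CurveInv O m k x a b) (hgap : K * (b - a) ≤ δ) :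
    OnCurve O m k η x a := by
  have hab := h.le
  refine ⟨hx, h.le_left, h.le.trans h.right_le, h.left, fun hd => h.right δ hδ ?_⟩
  refine hd.perturb (d := δ) (fun i hi l => ?_) (by linarith)
  refine (cutValue_perturb hO hK hx h.le_left (h.le.trans h.right_le) hx (h.le_left.trans h.le)
    h.right_le i hi l).trans ?_
  rwa [sub_self, abs_zero, zero_add, abs_sub_comm, abs_of_nonneg (by linarith)]

theorem runs_curveStep {x : ℝ} (h : Env m k K δ s) (hx : s.real 13 = x)
    (hi : CurveInv O m k x (s.real 15) (s.real 16))
    (hgap : K * (s.real 16 - s.real 15) ≤ s.real 17) :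
    Runs O curveStep s (10 * m + 8) fun s' => (Agree 14 s s' ∧
      CurveInv O m k x (s'.real 15) (s'.real 16) ∧
      K * (s'.real 16 - s'.real 15) ≤ s'.real 17) ∧ s'.real 17 = s.real 17 / 2 := by
  set c := (s.real 15 + s.real 16) / 2 with hc
  have hab := hi.le
  have hac : s.real 15 ≤ c := by linarith
  have hcb : c ≤ s.real 16 := by linarith
  have hL : K * (s.real 16 - c) = K * (s.real 16 - s.real 15) / 2 := by rw [hc]; ring
  have hR : K * (c - s.real 15) = K * (s.real 16 - s.real 15) / 2 := by rw [hc]; ring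
  unfold curveStep
  refine (runs_block (T := (10 * m + 4 + 1) + 1) ?_).mono (by simp) fun _ h => h
  simp only [List.foldl, Instr.apply]
  set s₁ := (s.setReal 14 _).setReal 14 _ with hs₁
  have ha₁ : Agree 14 s s₁ := ((Agree.refl 14 s).setReal le_rfl _).setReal le_rfl _
  have e13 : s₁.real 13 = x := by simp [hs₁, hx]
  have e14 : s₁.real 14 = c := by simp [hs₁, h.half, hc]; ring
  have e15 : s₁.real 15 = s.real 15 := by simp [hs₁]
  have e16 : s₁.real 16 = s.real 16 := by simp [hs₁]
  have e17 : s₁.real 17 = s.real 17 := by simp [hs₁]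
  have h₁ := h.agree ha₁ (by norm_num)
  refine Runs.seq (R := fun s' => Agree 14 s s' ∧ CurveInv O m k x (s'.real 15) (s'.real 16) ∧
    K * (s'.real 16 - s'.real 15) ≤ s.real 17 / 2 ∧ s'.real 17 = s.real 17)
    (runs_demandTest h₁ (by norm_num) 2 (fun hd s₂ h₂ => runs_instr ?_)
      fun hd s₂ h₂ => runs_instr ?_) ?_
  · rw [e13, e14, h₁.zero] at hd
    refine ⟨(ha₁.trans h₂ (by norm_num)).setReal (by norm_num) _, ?_⟩
    simp only [Instr.apply, Store.setReal_real]
    norm_num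
    rw [h₂.2 14 (by norm_num), h₂.2 16 (by norm_num), h₂.2 17 (by norm_num), e14, e16, e17]
    exact ⟨⟨hi.le_left.trans hac, hcb, hi.right_le, Or.inl hd, hi.right⟩, by linarith, rfl⟩
  · rw [e13, e14, h₁.zero] at hd
    refine ⟨(ha₁.trans h₂ (by norm_num)).setReal (by norm_num) _, ?_⟩
    simp only [Instr.apply, Store.setReal_real]
    norm_num
    rw [h₂.2 14 (by norm_num), h₂.2 15 (by norm_num), h₂.2 17 (by norm_num), e14, e15, e17]
    exact ⟨⟨hi.le_left, hac, hcb.trans hi.right_le, hi.left, fun t ht hd' => hd (hd'.anti ht.le)⟩,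
      by linarith, rfl⟩
  · rintro s₂ ⟨h2, h3, h4, h5⟩
    refine runs_instr ⟨⟨h2.setReal (by norm_num) _, ?_⟩, ?_⟩
    · simp only [Instr.apply, Store.setReal_real]
      norm_num
      rw [h5, (h.agree h2 (by norm_num)).half]
      exact ⟨h3, by linarith⟩
    · simp only [Instr.apply, Store.setReal_real]
      norm_num
      rw [h5, (h.agree h2 (by norm_num)).half]
      ring

theorem runs_findCurve (hO : O.Regular m K) (hK : 0 ≤ K) (hk' : ∀ j, 0 < k j) (hδ : 0 < δ)
    (hη : η = 3 * δ) (hN : K ≤ 2 ^ N * δ) (h : Env m k K δ s) (hx0 : 0 ≤ s.real 13)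
    (hx1 : s.real 13 ≤ 1) :
    Runs O findCurve s (N * (10 * m + 9) + 5) fun s' => Agree 14 s s' ∧
      OnCurve O m k η (s.real 13) (s'.real 14) := by
  unfold findCurve
  refine (runs_block (T := N * (10 * m + 8 + 1) + 1 + 1) ?_).mono (by simp) fun _ h => h
  refine Runs.seq (runs_halving (δ := δ) (fun s' => Agree 14 s s' ∧
    CurveInv O m k (s.real 13) (s'.real 15) (s'.real 16) ∧
      K * (s'.real 16 - s'.real 15) ≤ s'.real 17)
    (fun s' h' => (h.agree h'.1 (by norm_num)).acc) (fun s' h' => ?_) ?_ ?_) ?_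
  · refine (runs_curveStep (h.agree h'.1 (by norm_num)) (h'.1.2 13 (by norm_num)) h'.2.1
      h'.2.2).mono le_rfl fun s'' h'' => ⟨⟨h'.1.trans h''.1.1 le_rfl, h''.1.2⟩, h''.2⟩
  · refine ⟨(((Agree.refl 14 s).setReal (by norm_num) _).setReal (by norm_num) _).setReal
      (by norm_num) _, ?_⟩
    simp only [List.foldl, Instr.apply, Store.setReal_real]
    norm_num
    rw [h.one, h.lip]
    refine ⟨⟨le_rfl, hx1, le_rfl, Or.inr rfl, fun t ht =>
      not_demand_of_least (hk' 2) (cutValue_two_least hO hx0 hx1) ht⟩, ?_⟩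
    exact mul_le_of_le_one_right hK (by linarith)
  · simp [Instr.apply, h.lip, hN]
  · rintro s₁ ⟨⟨h1, h2, h3⟩, h4⟩
    refine runs_instr ⟨h1.setReal le_rfl _, ?_⟩
    simpa [Instr.apply] using h2.onCurve hO hK hδ hη hx0 (h3.trans h4)

/-! ### Bisection for the first cut -/

/-- Run `p` at points with a left label for the margin in register `5` (its negative is in register
`6`), otherwise `q`. -/
def labelTest (p q : Program) : Program := demandTest 0 5 q (demandTest 1 6 p q)

theorem runs_labelTest (h : Env m k K δ s) {t x y : ℝ} (hx : s.real 13 = x) (hy : s.real 14 = y)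
    (h5 : s.real 5 = t) (h6 : s.real 6 = -t) {p q : Program}
    (hp : LeftLabel O m k t x y → ∀ s', Agree 20 s s' → Runs O p s' T Q)
    (hq : ¬ LeftLabel O m k t x y → ∀ s', Agree 20 s s' → Runs O q s' T Q) :
    Runs O (labelTest p q) s (20 * m + 8 + T) Q := by
  have hlen : T ≤ 10 * m + 4 + T := by omega
  refine (runs_demandTest (T := 10 * m + 4 + T) h (by norm_num) 0 (fun hd s₁ h₁ => ?_)
    fun hd s₁ h₁ => runs_demandTest (h.agree h₁ (by norm_num)) (by norm_num) 1
      (fun hd' s₂ h₂ => ?_) fun hd' s₂ h₂ => ?_).mono (by omega) fun _ h => h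
  · rw [hx, hy, h5] at hd
    exact (hq (fun hl => hl.1 hd) s₁ h₁).mono hlen fun _ h => h
  all_goals
    rw [hx, hy, h5] at hd
    rw [h₁.2 13 (by norm_num), h₁.2 14 (by norm_num), h₁.2 6 (by norm_num), hx, hy, h6] at hd'
  · exact hp ⟨hd, hd'⟩ s₂ (h₁.trans h₂ le_rfl)
  · exact hq (fun hl => hd' hl.2) s₂ (h₁.trans h₂ le_rfl)

/-- One step of the bisection for the first cut. The left point of the curve is in registers `9`
and `11`, the right one in `10` and `12`, and register `1` holds a bound for `K` times the distance
of the two first cuts. -/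
def firstCutStep : Program :=
  block [.realAdd 13 9 10, .realMul 13 13 8]
    (.seq findCurve
      (.seq (demandTest 2 3
          (labelTest (block [.realCopy 9 13] (.instr (.realCopy 11 14)))
            (block [.realCopy 10 13] (.instr (.realCopy 12 14))))
          (block [.realCopy 10 13] (.instr (.realCopy 12 14))))
        (.instr (.realMul 1 1 8))))

/-- Invariant of the bisection for the first cut, between the points `(x, y)` and `(x', y')` of the
curve. -/
structure FirstCutInv (O : Oracle) (m : ℕ) (k : Fin 3 → ℕ) (η x y x' y' : ℝ) : Prop where
  le : x ≤ x'
  left_curve : OnCurve O m k η x y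
  right_curve : OnCurve O m k η x' y'
  left_demand : Demand m k (cutValue O x y) 2 0
  left : LeftLabel O m k η x y
  right : RightLabel O m k η x' y'

/-- The store during the bisection for the first cut. -/
structure FirstCutStore (O : Oracle) (m : ℕ) (k : Fin 3 → ℕ) (K δ η : ℝ) (s : Store) : Prop where
  env : Env m k K δ s
  margin : s.real 5 = η
  neg_margin : s.real 6 = -η
  gap : K * (s.real 10 - s.real 9) ≤ s.real 1
  inv : FirstCutInv O m k η (s.real 9) (s.real 11) (s.real 10) (s.real 12)

theorem runs_firstCutStep (hO : O.Regular m K) (hK : 0 ≤ K) (hk : k 0 + k 1 + k 2 = m + 1)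
    (hk' : ∀ j, 0 < k j) (hδ : 0 < δ) (hη : η = 3 * δ) (hN : K ≤ 2 ^ N * δ)
    (h : FirstCutStore O m k K δ η s) :
    Runs O firstCutStep s (N * (10 * m + 9) + 30 * m + 22) fun s' =>
      FirstCutStore O m k K δ η s' ∧ s'.real 1 = s.real 1 / 2 := by
  have hη0 : 0 < η := by linarith
  have hi := h.inv
  set c := (s.real 9 + s.real 10) / 2 with hc
  have hle := hi.le
  have hac : s.real 9 ≤ c := by linarith
  have hcb : c ≤ s.real 10 := by linarith
  have hL : K * (s.real 10 - c) = K * (s.real 10 - s.real 9) / 2 := by rw [hc]; ring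
  have hR : K * (c - s.real 9) = K * (s.real 10 - s.real 9) / 2 := by rw [hc]; ring
  have hgap := h.gap
  have hc0 : 0 ≤ c := hi.left_curve.nonneg.trans hac
  have hc1 : c ≤ 1 := hcb.trans (hi.right_curve.le.trans hi.right_curve.le_one)
  unfold firstCutStep
  refine (runs_block (T := (N * (10 * m + 9) + 5) + ((10 * m + 4 + (20 * m + 8 + 2)) + 1))
    ?_).mono (by simp; omega) fun _ h => h
  simp only [List.foldl, Instr.apply]
  set s₁ := (s.setReal 13 _).setReal 13 _ with hs₁
  have ha₁ : Agree 13 s s₁ := ((Agree.refl 13 s).setReal le_rfl _).setReal le_rfl _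
  have e13 : s₁.real 13 = c := by simp [hs₁, h.env.half, hc]; ring
  have h₁ := h.env.agree ha₁ (by norm_num)
  have hf := runs_findCurve hO hK hk' hδ hη hN h₁ (by rwa [e13]) (by rwa [e13])
  rw [e13] at hf
  refine hf.seq ?_
  rintro s₂ ⟨ha₂, hcurve⟩
  have ha : Agree 13 s s₂ := ha₁.trans ha₂ (by norm_num)
  have h₂ := h.env.agree ha (by norm_num)
  have f13 : s₂.real 13 = c := by rw [ha₂.2 13 (by norm_num), e13]
  refine Runs.seq (R := fun s' => Env m k K δ s' ∧ s'.real 5 = η ∧ s'.real 6 = -η ∧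
    s'.real 1 = s.real 1 ∧ K * (s'.real 10 - s'.real 9) ≤ s.real 1 / 2 ∧
    FirstCutInv O m k η (s'.real 9) (s'.real 11) (s'.real 10) (s'.real 12)) ?_ ?_
  · have hright : ¬ (Demand m k (cutValue O c (s₂.real 14)) 2 0 ∧
        LeftLabel O m k η c (s₂.real 14)) → ∀ s', Agree 20 s₂ s' →
        Runs O (block [.realCopy 10 13] (.instr (.realCopy 12 14))) s' 2
          (fun s' => Env m k K δ s' ∧ s'.real 5 = η ∧ s'.real 6 = -η ∧
            s'.real 1 = s.real 1 ∧ K * (s'.real 10 - s'.real 9) ≤ s.real 1 / 2 ∧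
            FirstCutInv O m k η (s'.real 9) (s'.real 11) (s'.real 10) (s'.real 12)) := by
      intro hno s' h'
      have ha' : Agree 13 s s' := ha.trans h' (by norm_num)
      refine runs_block (T := 1) (runs_instr ⟨((h₂.agree h' (by norm_num)).setReal
        (by norm_num) _).setReal (by norm_num) _, ?_⟩)
      simp only [List.foldl, Instr.apply, Store.setReal_real]
      norm_num
      rw [ha'.2 5 (by norm_num), ha'.2 6 (by norm_num), ha'.2 1 (by norm_num),
        ha'.2 9 (by norm_num), ha'.2 11 (by norm_num), h'.2 13 (by norm_num),
        h'.2 14 (by norm_num), f13]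
      exact ⟨h.margin, h.neg_margin, rfl, by linarith, hac, hi.left_curve, hcurve, hi.left_demand,
        hi.left, hcurve.rightLabel hO hk hk' hη0 hno⟩
    refine runs_demandTest h₂ (by norm_num) 2 (fun hd s₃ h₃ => ?_) fun hd s₃ h₃ => ?_
    · rw [f13, h₂.zero] at hd
      refine runs_labelTest (x := c) (y := s₂.real 14) (t := η) (h₂.agree h₃ (by norm_num))
        (by rw [h₃.2 13 (by norm_num), f13]) (h₃.2 14 (by norm_num))
        (by rw [h₃.2 5 (by norm_num), ha.2 5 (by norm_num), h.margin])
        (by rw [h₃.2 6 (by norm_num), ha.2 6 (by norm_num), h.neg_margin])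
        (fun hl s' h' => ?_) fun hl s' h' => hright (fun hh => hl hh.2) s' (h₃.trans h' le_rfl)
      have h' := h₃.trans h' le_rfl
      have ha' : Agree 13 s s' := ha.trans h' (by norm_num)
      refine runs_block (T := 1) (runs_instr ⟨((h₂.agree h' (by norm_num)).setReal
        (by norm_num) _).setReal (by norm_num) _, ?_⟩)
      simp only [List.foldl, Instr.apply, Store.setReal_real]
      norm_num
      rw [ha'.2 5 (by norm_num), ha'.2 6 (by norm_num), ha'.2 1 (by norm_num),
        ha'.2 10 (by norm_num), ha'.2 12 (by norm_num), h'.2 13 (by norm_num),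
        h'.2 14 (by norm_num), f13]
      exact ⟨h.margin, h.neg_margin, rfl, by linarith, hcb, hcurve, hi.right_curve, hd, hl,
        hi.right⟩
    · rw [f13, h₂.zero] at hd
      exact (hright (fun hh => hd hh.1) s₃ h₃).mono (by omega) fun _ h => h
  · rintro s₃ ⟨h1, h2, h3, h4, h5, h6⟩
    have e : s₃.real 1 * s₃.real 8 = s.real 1 / 2 := by rw [h4, h1.half]; ring
    refine runs_instr ⟨⟨h1.setReal (by norm_num) _, ?_, ?_, ?_, ?_⟩, ?_⟩ <;>
      simp only [Instr.apply, Store.setReal_real] <;> norm_num <;> try rw [e]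
    exacts [h2, h3, h5, h6]

/-! ### Bisection in a column -/

/-- One step of the bisection in the column with the first cut in registers `9` and `13`. The ends
of the bracket are in registers `11` and `12`, and register `1` holds a bound for `K` times their
distance. -/
def columnStep : Program :=
  block [.realAdd 14 11 12, .realMul 14 14 8]
    (.seq (labelTest (.instr (.realCopy 11 14)) (.instr (.realCopy 12 14)))
      (.instr (.realMul 1 1 8)))

/-- The store during the bisection in a column. -/
structure ColumnStore (O : Oracle) (m : ℕ) (k : Fin 3 → ℕ) (K δ η : ℝ) (s : Store) : Prop where
  env : Env m k K δ s
  margin : s.real 5 = 2 * η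
  neg_margin : s.real 6 = -(2 * η)
  first : s.real 13 = s.real 9
  nonneg : 0 ≤ s.real 9
  gap : K * |s.real 11 - s.real 12| ≤ s.real 1
  bracket : Bracket O m k η (s.real 9) (s.real 11) (s.real 12)

theorem runs_columnStep (hO : O.Regular m K) (hk : k 0 + k 1 + k 2 = m + 1) (hη : 0 < η)
    (h : ColumnStore O m k K δ η s) :
    Runs O columnStep s (20 * m + 12) fun s' =>
      ColumnStore O m k K δ η s' ∧ s'.real 1 = s.real 1 / 2 := by
  have hi := h.bracket
  have hgap := h.gap
  set c := (s.real 11 + s.real 12) / 2 with hc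
  have hL : K * |c - s.real 12| = K * |s.real 11 - s.real 12| / 2 := by
    rw [show c - s.real 12 = (s.real 11 - s.real 12) / 2 by rw [hc]; ring, abs_div, abs_two]
    ring
  have hR : K * |s.real 11 - c| = K * |s.real 11 - s.real 12| / 2 := by
    rw [show s.real 11 - c = (s.real 11 - s.real 12) / 2 by rw [hc]; ring, abs_div, abs_two]
    ring
  unfold columnStep
  refine (runs_block (T := (20 * m + 8 + 1) + 1) ?_).mono (by simp) fun _ h => h
  simp only [List.foldl, Instr.apply]
  set s₁ := (s.setReal 14 _).setReal 14 _ with hs₁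
  have ha : Agree 14 s s₁ := ((Agree.refl 14 s).setReal le_rfl _).setReal le_rfl _
  have e14 : s₁.real 14 = c := by simp [hs₁, h.env.half, hc]; ring
  have h₁ := h.env.agree ha (by norm_num)
  refine Runs.seq (R := fun s' => Env m k K δ s' ∧ s'.real 5 = 2 * η ∧ s'.real 6 = -(2 * η) ∧
    s'.real 13 = s.real 9 ∧ s'.real 9 = s.real 9 ∧
    s'.real 1 = s.real 1 ∧ K * |s'.real 11 - s'.real 12| ≤ s.real 1 / 2 ∧
    Bracket O m k η (s.real 9) (s'.real 11) (s'.real 12))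
    (runs_labelTest (x := s.real 9) (y := c) (t := 2 * η) h₁ (by simp [hs₁, h.first]) e14
      (by simp [hs₁, h.margin]) (by simp [hs₁, h.neg_margin]) (fun hl s' h' => ?_)
      fun hl s' h' => ?_) ?_
  · have ha' : Agree 14 s s' := ha.trans h' (by norm_num)
    refine runs_instr ⟨(h₁.agree h' (by norm_num)).setReal (by norm_num) _, ?_⟩
    simp only [Instr.apply, Store.setReal_real]
    norm_num
    rw [ha'.2 5 (by norm_num), ha'.2 6 (by norm_num), ha'.2 1 (by norm_num),
      ha'.2 9 (by norm_num), ha'.2 12 (by norm_num), ha'.2 13 (by norm_num),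
      h'.2 14 (by norm_num), e14]
    exact ⟨h.margin, h.neg_margin, h.first, rfl, rfl, by linarith, hi.mid_left hO h.nonneg hc hl⟩
  · have ha' : Agree 14 s s' := ha.trans h' (by norm_num)
    refine runs_instr ⟨(h₁.agree h' (by norm_num)).setReal (by norm_num) _, ?_⟩
    simp only [Instr.apply, Store.setReal_real]
    norm_num
    rw [ha'.2 5 (by norm_num), ha'.2 6 (by norm_num), ha'.2 1 (by norm_num),
      ha'.2 9 (by norm_num), ha'.2 11 (by norm_num), ha'.2 13 (by norm_num),
      h'.2 14 (by norm_num), e14]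
    exact ⟨h.margin, h.neg_margin, h.first, rfl, rfl, by linarith,
      hi.mid_right hO hk h.nonneg hη hc hl⟩
  · rintro s₃ ⟨h1, h2, h3, h4, h5, h6, h7, h8⟩
    have e : s₃.real 1 * s₃.real 8 = s.real 1 / 2 := by rw [h6, h1.half]; ring
    refine runs_instr ⟨⟨h1.setReal (by norm_num) _, ?_, ?_, ?_, ?_, ?_, ?_⟩, ?_⟩ <;>
      simp only [Instr.apply, Store.setReal_real] <;> norm_num <;> try rw [e]
    exacts [h2, h3, h4.trans h5.symm, h5 ▸ h.nonneg, h7, h5.symm ▸ h8]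

/-! ### The algorithm -/

/-- Set up the constants, `δ = ε / 8` and the margin `3 δ`, and the bracket of the bisection for the
first cut: the point of the curve with `x = 0`, and the point `(1, 1)`. -/
def setup : Program :=
  block [.natConst 5 1, .natSub 4 0 5, .realConst 4 1, .realConst 8 (1 / 2), .realConst 2 (1 / 8),
      .realMul 2 2 1, .realAdd 5 2 2, .realAdd 5 5 2, .realSub 6 3 5, .realCopy 1 0,
      .realCopy 10 4, .realCopy 12 4]
    (.seq findCurve (.instr (.realCopy 11 14)))

/-- Prepare the bisection in the column of the first cut, with the doubled margin. -/
def setupColumn (p : Program) : Program :=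
  block [.realCopy 13 9, .realCopy 1 0, .realAdd 5 5 5, .realAdd 6 6 6] p

/-- Write the division with the cuts in registers `9` and `11` to the output registers. -/
def output : Program :=
  block [.realCopy 5 4, .realCopy 0 3, .realCopy 1 9, .realCopy 2 9, .realCopy 3 11]
    (.instr (.realCopy 4 11))

/-- The division algorithm. -/
def divide : Program :=
  .seq setup (.seq (.loop (.realLt 2 1) firstCutStep)
    (.seq (setupColumn (.loop (.realLt 2 1) columnStep)) output))

theorem runs_setup {n : ℕ} {ε : ℝ} (hn : n = m + 1) (hO : O.Regular m K) (hK : 0 ≤ K)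
    (hk : k 0 + k 1 + k 2 = m + 1) (hk' : ∀ j, 0 < k j) (hε : 0 < ε) (hδ : δ = ε / 8)
    (hη : η = 3 * δ) (hN : K ≤ 2 ^ N * δ) :
    Runs O setup (inputStore n k K ε) (N * (10 * m + 9) + 18) fun s =>
      FirstCutStore O m k K δ η s ∧ s.real 1 = K := by
  have hδ0 : 0 < δ := by linarith
  have hη0 : 0 < η := by linarith
  unfold setup
  refine (runs_block (T := (N * (10 * m + 9) + 5) + 1) ?_).mono (by simp) fun _ h => h
  generalize hs₁ : List.foldl (fun s c => Instr.apply O s c) (inputStore n k K ε) _ = s₁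
  have h₁ : Env m k K δ s₁ := by
    subst hs₁
    refine ⟨fun j => ?_, ?_, ?_, ?_, ?_, ?_, ?_, ?_⟩
    · fin_cases j <;> simp [Instr.apply, inputStore]
    · simp [Instr.apply, inputStore, hn]
    · simp [Instr.apply, inputStore]
    · simp [Instr.apply, inputStore]
    · simp [Instr.apply, inputStore, hδ]; ring
    · simp [Instr.apply, inputStore]
    · simp [Instr.apply, inputStore]
    · simp [Instr.apply, inputStore]
  have e5 : s₁.real 5 = η := by subst hs₁; simp [Instr.apply, inputStore, hη, hδ]; ring
  have e6 : s₁.real 6 = -η := by subst hs₁; simp [Instr.apply, inputStore, hη, hδ]; ring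
  have e1 : s₁.real 1 = K := by subst hs₁; simp [Instr.apply, inputStore]
  have e9 : s₁.real 9 = 0 := by subst hs₁; simp [Instr.apply, inputStore]
  have e10 : s₁.real 10 = 1 := by subst hs₁; simp [Instr.apply, inputStore]
  have e12 : s₁.real 12 = 1 := by subst hs₁; simp [Instr.apply, inputStore]
  have e13 : s₁.real 13 = 0 := by subst hs₁; simp [Instr.apply, inputStore]
  have hf := runs_findCurve hO hK hk' hδ0 hη hN h₁ e13.ge (e13.trans_le zero_le_one)
  rw [e13] at hf
  refine hf.seq ?_
  rintro s₂ ⟨ha, hcurve⟩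
  obtain ⟨hd, hl⟩ := hcurve.leftLabel_zero hO hk hk' hη0
  refine runs_instr ⟨⟨(h₁.agree ha (by norm_num)).setReal (by norm_num) _, ?_, ?_, ?_, ?_⟩, ?_⟩ <;>
    simp only [Instr.apply, Store.setReal_real] <;> norm_num
  · rw [ha.2 5 (by norm_num), e5]
  · rw [ha.2 6 (by norm_num), e6]
  · rw [ha.2 10 (by norm_num), ha.2 9 (by norm_num), ha.2 1 (by norm_num), e10, e9, e1]
    simp
  · rw [ha.2 9 (by norm_num), ha.2 10 (by norm_num), ha.2 12 (by norm_num), e9, e10, e12]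
    exact ⟨zero_le_one, hcurve, onCurve_one hO hk' hη0, hd, hl, rightLabel_one hO hk hk' hη0⟩
  · rw [ha.2 1 (by norm_num), e1]

theorem runs_divide {n : ℕ} {ε : ℝ} (hn : n = m + 1) (hO : O.Regular m K) (hK : 0 ≤ K)
    (hk : k 0 + k 1 + k 2 = m + 1) (hk' : ∀ j, 0 < k j) (hε : 0 < ε) (hN : K ≤ 2 ^ N * (ε / 8)) :
    Runs O divide (inputStore n k K ε) (100 * n * (N + 1) ^ 2) fun s =>
      ∃ x y, 0 ≤ x ∧ x ≤ y ∧ y ≤ 1 ∧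
        (s.real 0 = 0 ∧ s.real 1 = x ∧ s.real 2 = x ∧ s.real 3 = y ∧ s.real 4 = y ∧
          s.real 5 = 1) ∧
        ∀ j, Demand m k (cutValue O x y) j (-ε) ∧ ¬ Demand m k (cutValue O x y) j ε := by
  obtain ⟨δ, hδ⟩ : ∃ δ, δ = ε / 8 := ⟨_, rfl⟩
  obtain ⟨η, hη⟩ : ∃ η, η = 3 * δ := ⟨_, rfl⟩
  have hδ0 : 0 < δ := by linarith
  have hη0 : 0 < η := by linarith
  rw [← hδ] at hN
  have hε8 : ε = 8 * δ := by linarith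
  refine ((runs_setup hn hO hK hk hk' hε hδ hη hN).seq (T₂ :=
    (N * (N * (10 * m + 9) + 30 * m + 22 + 1) + 1) + ((N * (20 * m + 12 + 1) + 1 + 4) + 6))
    ?_).mono ?_ fun _ h => h
  swap
  · subst hn
    nlinarith [Nat.zero_le (N * N * m), Nat.zero_le (N * N), Nat.zero_le (N * m)]
  rintro s₁ ⟨h₁, e₁⟩
  refine (runs_halving (δ := δ) (FirstCutStore O m k K δ η) (fun s h => h.env.acc)
    (fun s h => runs_firstCutStep hO hK hk hk' hδ0 hη hN h) h₁ (by rwa [e₁])).seq ?_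
  rintro s₂ ⟨h₂, e₂⟩
  refine (Runs.seq (R := fun s => ColumnStore O m k K δ η s ∧ s.real 1 ≤ δ) ?_ ?_)
  · refine runs_block (runs_halving (δ := δ) (ColumnStore O m k K δ η) (fun s h => h.env.acc)
      (fun s h => runs_columnStep hO hk hη0 h) ?_ ?_)
    · have hi := h₂.inv
      have hb := hi.left_curve.bracket hO hK hδ0 hη hi.right_curve hi.le (h₂.gap.trans e₂)
        hi.left_demand hi.left hi.right
      refine ⟨(((h₂.env.setReal (by norm_num) _).setReal (by norm_num) _).setReal
        (by norm_num) _).setReal (by norm_num) _, ?_, ?_, ?_, ?_, ?_, ?_⟩ <;>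
        simp only [List.foldl, Instr.apply, Store.setReal_real] <;> norm_num
      · rw [h₂.margin]; ring
      · rw [h₂.neg_margin]; ring
      · exact hi.left_curve.nonneg
      · rw [h₂.env.lip]
        refine mul_le_of_le_one_right hK (abs_le.2 ⟨?_, ?_⟩)
        · linarith [hi.left_curve.nonneg, hi.left_curve.le, hi.right_curve.le_one]
        · linarith [hi.right_curve.nonneg, hi.right_curve.le, hi.left_curve.le_one]
      · exact hb
    · simpa [Instr.apply, h₂.env.lip] using hN
  · rintro s₃ ⟨h₃, e₃⟩
    have hb := h₃.bracket
    refine runs_block (T := 1) (runs_instr ⟨s₃.real 9, s₃.real 11, h₃.nonneg, hb.left_mem.1,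
      hb.left_mem.2, ?_, fun j => ?_⟩)
    · simp [Instr.apply, h₃.env.zero, h₃.env.one]
    · rw [hε8]
      exact hb.solution hO hK hδ0 hη h₃.nonneg (h₃.gap.trans e₃) j

end Search

/-! ### The division and the time bound -/

/-- The division with the cuts `x` and `y`. -/
def cutDivision (x y : ℝ) (hx : 0 ≤ x) (hxy : x ≤ y) (hy : y ≤ 1) : Fin 3 → Piece :=
  ![Piece.interval 0 x ⟨le_rfl, hx, hxy.trans hy⟩, Piece.interval x y ⟨hx, hxy, hy⟩,
    Piece.interval y 1 ⟨hx.trans hxy, hy, le_rfl⟩]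

section Division

variable {x y : ℝ} {hx : 0 ≤ x} {hxy : x ≤ y} {hy : y ≤ 1}

theorem cutDivision_isDivision : IsDivision (cutDivision x y hx hxy hy) := by
  constructor
  · ext z
    simp only [mem_iUnion, Fin.exists_fin_succ, cutDivision, Piece.interval, Piece.carrier]
    simp only [mem_Icc, IsEmpty.exists_iff, or_false]
    constructor
    · rintro (h | h | h) <;> constructor <;> linarith [h.1, h.2]
    · rintro ⟨h0, h1⟩
      rcases le_total z x with h | h
      · exact Or.inl ⟨h0, h⟩
      rcases le_total z y with h' | h'
      · exact Or.inr (Or.inl ⟨h, h'⟩)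
      · exact Or.inr (Or.inr ⟨h', h1⟩)
  · have key : ∀ a b c d : ℝ, b ≤ c → Disjoint (Ioo a b) (Ioo c d) := fun a b c d h =>
      disjoint_left.2 fun z hz hz' => by linarith [hz.2, hz'.1]
    intro i j hij
    fin_cases i <;> fin_cases j
    all_goals first
      | exact absurd rfl hij
      | change Disjoint (interior (Icc _ _)) (interior (Icc _ _))
        rw [interior_Icc, interior_Icc]
        first
        | exact key _ _ _ _ (by linarith)
        | exact (key _ _ _ _ (by linarith)).symm

theorem cutDivision_isContiguous (j : Fin 3) : (cutDivision x y hx hxy hy j).IsContiguous := by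
  fin_cases j
  exacts [⟨0, x, hx, rfl⟩, ⟨x, y, hxy, rfl⟩, ⟨y, 1, hy, rfl⟩]

theorem cutDivision_outputs {s : Store} (h : s.real 0 = 0 ∧ s.real 1 = x ∧ s.real 2 = x ∧
    s.real 3 = y ∧ s.real 4 = y ∧ s.real 5 = 1) : Outputs s (cutDivision x y hx hxy hy) := by
  obtain ⟨h0, h1, h2, h3, h4, h5⟩ := h
  intro j
  fin_cases j <;>
    simp [cutDivision, Piece.interval, Piece.carrier, h0, h1, h2, h3, h4, h5, hx, hxy, hy]

theorem cutValue_valueOracle {n : ℕ} (v : Fin n → Valuation) {i : Fin n} (hi : i.val + 1 < n)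
    (j : Fin 3) :
    cutValue (valueOracle v) x y i j = v i (cutDivision x y hx hxy hy j) := by
  fin_cases j
  · exact dif_pos ⟨hi, le_rfl, hx, hxy.trans hy⟩
  · exact dif_pos ⟨hi, hx, hxy, hy⟩
  · exact dif_pos ⟨hi, hx.trans hxy, hy, le_rfl⟩

end Division

/-- The number of halvings that take `K` below `ε / 8` is logarithmic in `K / ε`. -/
theorem exists_halvings {K ε : ℝ} (hK : 0 ≤ K) (hε : 0 < ε) :
    ∃ N : ℕ, K ≤ 2 ^ N * (ε / 8) ∧ (N + 1 : ℝ) ≤ 10 * Real.log (2 + K / ε) := by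
  set r := K / ε with hr
  have hr0 : 0 ≤ r := by positivity
  have hl2 := Real.log_two_gt_d9
  have hlog : Real.log 2 ≤ Real.log (2 + r) := Real.log_le_log (by norm_num) (by linarith)
  refine ⟨⌈Real.logb 2 (2 + r)⌉₊ + 3, ?_, ?_⟩
  · have h1 : 2 + r ≤ 2 ^ ⌈Real.logb 2 (2 + r)⌉₊ := by
      rw [← Real.rpow_natCast, ← Real.logb_le_iff_le_rpow (by norm_num) (by linarith)]
      exact Nat.le_ceil _
    have h2 : K = r * ε := by rw [hr]; field_simp
    rw [h2, pow_add]
    nlinarith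
  · have h0 : 0 ≤ Real.logb 2 (2 + r) := Real.logb_nonneg (by norm_num) (by linarith)
    have h1 := (Nat.ceil_lt_add_one h0).le
    have h2 : Real.logb 2 (2 + r) ≤ 2 * Real.log (2 + r) := by
      unfold Real.logb
      rw [div_le_iff₀ (by linarith)]
      nlinarith
    push_cast
    linarith

theorem exec_divide {n : ℕ} {k : Fin 3 → ℕ} {K ε : ℝ} {v : Fin n → Valuation} (hn : 3 ≤ n)
    (hk' : ∀ j, 0 < k j) (hk : k 0 + k 1 + k 2 = n) (hε : 0 < ε) (hm : ∀ i, (v i).IsMonotone)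
    (hl : ∀ i, (v i).IsLipschitz K) :
    ∃ (s : Store) (t : ℕ) (A : Fin 3 → Piece),
      Exec (valueOracle v) divide (inputStore n k K ε) s t ∧
      (t : ℝ) ≤ 10000 * n * (Real.log (2 + K / ε)) ^ 2 ∧
      Outputs s A ∧ IsDivision A ∧ (∀ j, (A j).IsContiguous) ∧
      IsApproxBirthdayEnvyFree v k ε A := by
  obtain ⟨m, rfl⟩ : ∃ m, n = m + 1 := ⟨n - 1, by omega⟩
  have hK : 0 ≤ K := (hl 0).nonneg
  obtain ⟨N, hN, hNlog⟩ := exists_halvings hK hε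
  obtain ⟨s, t, hexec, ht, x, y, hx, hxy, hy, hout, hdem⟩ :=
    runs_divide rfl (valueOracle_regular hm hl) hK hk hk' hε hN
  refine ⟨s, t, cutDivision x y hx hxy hy, hexec, ?_, cutDivision_outputs hout,
    cutDivision_isDivision, cutDivision_isContiguous, fun j₀ => ?_⟩
  · have h1 : (t : ℝ) ≤ 100 * ((m + 1 : ℕ) : ℝ) * (N + 1 : ℝ) ^ 2 := by exact_mod_cast ht
    have h2 : (N + 1 : ℝ) ^ 2 ≤ (10 * Real.log (2 + K / ε)) ^ 2 :=
      pow_le_pow_left₀ (by positivity) hNlog 2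
    calc (t : ℝ) ≤ 100 * ((m + 1 : ℕ) : ℝ) * (N + 1 : ℝ) ^ 2 := h1
      _ ≤ 100 * ((m + 1 : ℕ) : ℝ) * (10 * Real.log (2 + K / ε)) ^ 2 := by gcongr
      _ = 10000 * ((m + 1 : ℕ) : ℝ) * Real.log (2 + K / ε) ^ 2 := by ring
  · obtain ⟨π, hπ, hpref, hcard⟩ := exists_assignment hk hε.le (fun j => (hdem j).1)
      (fun j => (hdem j).2) j₀
    refine ⟨π, fun i hi => ?_, fun i hi j => ?_, hcard⟩
    · obtain rfl : i = Fin.last m := Fin.ext (by simpa using hi)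
      exact hπ
    · have := hpref i (by omega) j
      rwa [cutValue_valueOracle v hi, cutValue_valueOracle v hi] at this

end CakeCutting

/-- One program `P` and one constant `C` work for all instances. -/
theorem theorem4 :
    ∃ (P : CakeCutting.Program) (C : ℝ),
      ∀ (n : ℕ) (k : Fin 3 → ℕ) (K ε : ℝ) (v : Fin n → CakeCutting.Valuation),
        3 ≤ n → (∀ j, 0 < k j) → k 0 + k 1 + k 2 = n → 0 < ε →
        (∀ i, (v i).IsMonotone) → (∀ i, (v i).IsLipschitz K) →
        ∃ (s : CakeCutting.Store) (t : ℕ) (A : Fin 3 → CakeCutting.Piece),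
          CakeCutting.Exec (CakeCutting.valueOracle v) P (CakeCutting.inputStore n k K ε) s t ∧
          (t : ℝ) ≤ C * n * (Real.log (2 + K / ε)) ^ 2 ∧
          CakeCutting.Outputs s A ∧
          CakeCutting.IsDivision A ∧
          (∀ j, (A j).IsContiguous) ∧
          CakeCutting.IsApproxBirthdayEnvyFree v k ε A :=
  ⟨CakeCutting.divide, 10000, fun _ _ _ _ _ hn hk' hk hε hm hl =>
    CakeCutting.exec_divide hn hk' hk hε hm hl⟩
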